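/- **Model.** Time is divided into slots $t=1,\dots,T_{\mathrm{hor}}$ of $\tau$ seconds. An *execution* is a sequence $\mathcal E=(H_t,A_t)_{t\le T_{\mathrm{hor}}}$, where $H_t\sim\mathrm{Poisson}((1-\beta)\rho)$ and $A_t\sim\mathrm{Poisson}(\beta\rho)$, all independent, are the numbers of honest and of adversarial nodes that are eligible to propose a block in slot $t$ (at most a fraction $\beta$ of the nodes is corrupt). Slot $t$ is *uniquely successful* if $A_t=0$ and $H_t=1$. At the beginning of every slot each eligible honest node extends the longest chain that it has fully downloaded by one block with its pending valid transactions. Header chains broadcast by honest nodes reach all honest nodes within $\Delta_h$ seconds; every honest node rebroadcasts the valid header chains that it receives. After the first $\Delta_h$ seconds of a slot, every honest node requests block contents, in the order given by its download rule $\mathcal D$, from a repository that serves each node $C$ contents per second, that is, at most $C(\tau-\Delta_h)$ contents per slot. A content is adopted once its header chain is known and all earlier contents of the chain are adopted, if it matches the (binding) commitment in its header and is semantically valid. The adversary controls the corrupt nodes, which may produce any number of blocks from each of their present and past eligible slots on any valid chains with earlier tips; it schedules headers and downloads within the above bounds, pushes valid header chains and arbitrary contents to honest nodes irrespective of delay and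 bandwidth, withholds contents, and breaks all ties. The ledger $\mathrm{LOG}_i^t$ of an honest node $i$ at the end of slot $t$ is the part of its longest downloaded chain that consists of the blocks with time slot at most $t-T_{\mathrm{conf}}$. For an execution $\mathcal E$ and $K\in\mathbb N$, $\mathsf{MaxDL}_K(\mathcal E,\mathcal D)$ holds if, for all adversarial strategies, the block proposed in any uniquely successful slot is downloaded by all honest nodes within the first $K$ contents that they download in that slot. *Safety* holds in $\mathcal E$ if, for all adversarial strategies, all honest $i,j$ and all slots $t,t'$, one of $\mathrm{LOG}_i^t,\mathrm{LOG}_j^{t'}$ is a prefix of the other. *Liveness with parameter $T_{\mathrm{live}}$* holds in $\mathcal E$ if, for all adversarial strategies, every transaction received by all honest nodes before slot $t$ (that is, from slot $t$ on it is among the valid pending transactions of every honest node whose longest downloaded chain does not contain it) is in $\mathrm{LOG}_i^{t'}$ for all honest $i$ and all slots $t'\ge t+T_{\mathrm{live}}$, $t'\le T_{\mathrm{hor}}$. A function $f(\kappa)$ is *negligible* if for every $n>0$, $f(\kappa)<\kappa^{-n}$ for all large $\kappa$. **Theorem.** Let $\rho>0$, $\beta\ge 0$ and $\epsilon_1\in(0,1)$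 satisfy $(1-\beta)\rho e^{-\rho}=\frac{1-e^{-\rho}}{2}(1+\epsilon_1)$. There is a constant $c>0$, depending only on $\rho$, $\beta$ and $\epsilon_1$, such that the following holds. Let $K$, the download rule $\mathcal D$, $\tau$, $T_{\mathrm{hor}}$, $T_{\mathrm{conf}}$, $T_{\mathrm{live}}$ be functions of the security parameter $\kappa\in\mathbb N$, with $\tau=\Delta_h+K/C$, where $\Delta_h\ge 0$ and $C>0$, and suppose that $$\Pr\big[\mathcal E:\ \neg\mathsf{MaxDL}_K(\mathcal E,\mathcal D)\big]\ \text{ is negligible in }\kappa .$$ If, for all large $\kappa$, $$T_{\mathrm{conf}}\ge c\,(\kappa+\ln T_{\mathrm{hor}})^2\qquad\text{and}\qquad T_{\mathrm{live}}\ge T_{\mathrm{conf}}+c\,(\kappa+\ln T_{\mathrm{hor}})^2,$$ then proof-of-stake longest chain with download rule $\mathcal D$ is secure over the horizon $T_{\mathrm{hor}}$ with parameter $T_{\mathrm{live}}$: the probability that safety or liveness with parameter $T_{\mathrm{live}}$ fails in $\mathcal E$ is negligible in $\kappa$. In particular one may take $T_{\mathrm{conf}}=\lceil c(\kappa+\ln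 T_{\mathrm{hor}})^2\rceil$ and $T_{\mathrm{live}}=2T_{\mathrm{conf}}$. -/

import Mathlib

open MeasureTheory ProbabilityTheory Filter

universe u v

namespace PoSLC

/-! ### Header chains -/

/-- A block header: the claimed time slot, the identity of the producing node, and the
commitment to the block content. -/
structure Header (Digest : Type v) where
  time : ℕ
  node : ℕ
  txsHash : Digest

/-- A header chain, oldest header first; the genesis header chain is the empty list. A block is
identified with the header chain that ends in it, `C <+: C'` is the prefix relation, and the
height of a block is `C.length`. -/
abbrev Chain (Digest : Type v) := List (Header Digest)

/-- The time slot of the tip of a chain; the genesis block has time slot `0`. -/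
def tipTime {Digest : Type v} (C : Chain Digest) : ℕ := (C.getLast?.map Header.time).getD 0

/-- What a node knows about the content of a block. -/
inductive Content (Tx : Type u) where
  | unknown
  | invalid
  | known (txs : List Tx)

/-- The transactions of a block (none unless the content is known). -/
def Content.txs {Tx : Type u} : Content Tx → List Tx
  | .known l => l
  | _ => []

/-- The transactions as ordered in the listed blocks. -/
def blocksTxs {Tx : Type u} {Digest : Type v} (content : Chain Digest → Content Tx)
    (blocks : List (Chain Digest)) : List Tx :=
  blocks.flatMap fun C => (content C).txs

/-- The transactions as ordered in the chain `C` (all of its blocks, from genesis on). -/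
def chainTxs {Tx : Type u} {Digest : Type v} (content : Chain Digest → Content Tx)
    (C : Chain Digest) : List Tx :=
  blocksTxs content C.inits

/-- Every transaction of `txs` is valid with respect to its own prefix in the ledger that results
from appending `txs` to `ledger`. -/
def TxsValid {Tx : Type u} (txValid : List Tx → Tx → Prop) : List Tx → List Tx → Prop
  | _, [] => True
  | ledger, tx :: rest => txValid ledger tx ∧ TxsValid txValid (ledger ++ [tx]) rest

/-- The tip of `C` commits to the content `txs`. -/
def Commits {Tx : Type u} {Digest : Type v} (hash : List Tx → Digest) (C : Chain Digest)
    (txs : List Tx) : Prop :=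
  ∃ h, C.getLast? = some h ∧ h.txsHash = hash txs

/-! ### Local state of an honest node, and download rules -/

/-- What can happen to a node: it receives a header chain, it is handed a block content that it did
not download, or it downloads a block content from the repository. -/
inductive LocalEvent (Tx : Type u) (Digest : Type v) where
  | header (C : Chain Digest)
  | pushed (C : Chain Digest) (txs : List Tx)
  | downloaded (C : Chain Digest) (txs : List Tx)

structure NodeState (Tx : Type u) (Digest : Type v) where
  /-- the local header tree -/
  headers : Set (Chain Digest)
  /-- the local map from blocks to contents -/
  content : Chain Digest → Content Tx
  /-- the longest downloaded chain -/
  best : Chain Digest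
  /-- received contents whose handling is deferred -/
  deferred : Set (Chain Digest × List Tx)
  /-- the number of contents downloaded in the current slot -/
  downloads : ℕ
  /-- everything that the node received so far, with time stamps, latest first -/
  history : List (ℝ × LocalEvent Tx Digest)

/-- A download rule: given the current slot and the local state of a node, it says which block the
node requests next (`none`: no request). A rule may leave ties, which the adversary breaks, so it
is given by the nonempty set of the choices that it permits. -/
structure DownloadRule (Tx : Type u) (Digest : Type v) where
  choices : ℕ → NodeState Tx Digest → Set (Option (Chain Digest))
  nonempty : ∀ t s, (choices t s).Nonempty

/-- A received content for `C` can be handled: the header chain `C` was received, and the contents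
of all proper prefixes are downloaded and valid. -/
def NodeState.Ready {Tx : Type u} {Digest : Type v} (s : NodeState Tx Digest)
    (C : Chain Digest) : Prop :=
  C ∈ s.headers ∧ ∀ C', C' <+: C → C' ≠ C → ∃ txs, s.content C' = .known txs

/-- No deferred content can be handled at present. -/
def NodeState.Settled {Tx : Type u} {Digest : Type v} (s : NodeState Tx Digest) : Prop :=
  ∀ q ∈ s.deferred, ¬ s.Ready q.1

/-- `C` is downloaded (and valid) in the view of the node. -/
def NodeState.Downloaded {Tx : Type u} {Digest : Type v} (s : NodeState Tx Digest)
    (C : Chain Digest) : Prop :=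
  C ∈ s.headers ∧ ∃ txs, s.content C = .known txs

/-- `C` is a longest downloaded chain in the view of the node. -/
def NodeState.IsLongest {Tx : Type u} {Digest : Type v} (s : NodeState Tx Digest)
    (C : Chain Digest) : Prop :=
  s.Downloaded C ∧ ∀ C', s.Downloaded C' → C'.length ≤ C.length

/-- The transactions in the longest downloaded chain of the node. -/
def NodeState.bestTxs {Tx : Type u} {Digest : Type v} (s : NodeState Tx Digest) : List Tx :=
  chainTxs s.content s.best

/-! ### Protocol, environment and adversary -/

/-- The protocol with its download rule, and the parameters of the network: the binding
commitment `hash` to block contents, the rule `txValid` by which a transaction is semantically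
valid with respect to the ledger before it, the genesis content, the bound `headerDelay` on the
propagation delay of headers (seconds), the download bandwidth `bandwidth` of each honest node
(block contents per second), and the slot duration `slotDuration` (seconds). -/
structure Protocol (Tx : Type u) (Digest : Type v) where
  hash : List Tx → Digest
  txValid : List Tx → Tx → Prop
  genesisTxs : List Tx
  rule : DownloadRule Tx Digest
  headerDelay : ℝ
  bandwidth : ℝ
  slotDuration : ℝ

/-- The honest and the corrupt nodes, and those of them that win the block production lottery in
each slot. -/
structure Setup where
  honest : Finset ℕ
  corrupt : Finset ℕ
  honestLeaders : ℕ → Finset ℕ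
  corruptLeaders : ℕ → Finset ℕ

/-- The global state. -/
structure State (Tx : Type u) (Digest : Type v) where
  /-- current time -/
  now : ℝ
  /-- the valid header chains -/
  tree : Set (Chain Digest)
  /-- the repository of block contents -/
  repo : Set (Chain Digest × List Tx)
  /-- the header chains broadcast by honest nodes, with the times of these broadcasts -/
  sent : Set (Chain Digest × ℝ)
  /-- the local states of the (honest) nodes -/
  node : ℕ → NodeState Tx Digest

variable {Tx : Type u} {Digest : Type v}

open Classical in
/-- The state before the first slot. -/
noncomputable def Protocol.initialState (P : Protocol Tx Digest) : State Tx Digest where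
  now := 0
  tree := {[]}
  repo := ∅
  sent := ∅
  node := fun _ =>
    { headers := {[]}
      content := fun C => if C = [] then .known P.genesisTxs else .unknown
      best := []
      deferred := ∅
      downloads := 0
      history := [] }

/-- Replace the local state of node `i`. -/
def State.setNode (G : State Tx Digest) (i : ℕ) (s : NodeState Tx Digest) : State Tx Digest :=
  { G with node := Function.update G.node i s }

/-- The block that node `i` produces in slot `t` with content `txs`. -/
def State.newBlock (P : Protocol Tx Digest) (G : State Tx Digest) (t i : ℕ) (txs : List Tx) :
    Chain Digest :=
  (G.node i).best ++ [⟨t, i, P.hash txs⟩]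

/-- The functionality that validates new headers accepts the block of honest node `i` in slot
`t`. -/
def State.Proposes (S : Setup) (G : State Tx Digest) (t i : ℕ) : Prop :=
  i ∈ S.honestLeaders t ∧ (G.node i).best ∈ G.tree ∧ tipTime (G.node i).best < t

/-- Beginning of slot `t`: every honest leader extends its longest downloaded chain by one block
with the pending transactions `batch i`, uploads the content and broadcasts the header chain. -/
def State.beginSlot (P : Protocol Tx Digest) (S : Setup) (t : ℕ) (batch : ℕ → List Tx)
    (G : State Tx Digest) : State Tx Digest where
  now := G.now
  tree := G.tree ∪ {C | ∃ i, G.Proposes S t i ∧ C = G.newBlock P t i (batch i)}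
  repo := G.repo ∪ {q | ∃ i, G.Proposes S t i ∧ q = (G.newBlock P t i (batch i), batch i)}
  sent := G.sent ∪ {q | ∃ i, G.Proposes S t i ∧ q = (G.newBlock P t i (batch i), G.now)}
  node := fun i => { G.node i with downloads := 0 }

/-- All honest nodes have received the header chain `C`. -/
def State.Delivered (S : Setup) (G : State Tx Digest) (C : Chain Digest) : Prop :=
  ∀ i ∈ S.honest, C ∈ (G.node i).headers

/-- Every header chain that was broadcast at least `headerDelay` seconds ago has arrived at all
honest nodes. -/
def State.NothingDue (P : Protocol Tx Digest) (S : Setup) (G : State Tx Digest) : Prop :=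
  ∀ q ∈ G.sent, q.2 + P.headerDelay ≤ G.now → G.Delivered S q.1

/-- The bandwidth left to a node permits one more download in the current slot: the contents
downloaded in one slot fit into the part of the slot that follows the first `headerDelay`
seconds. -/
def NodeState.HasCapacity (P : Protocol Tx Digest) (s : NodeState Tx Digest) : Prop :=
  (s.downloads : ℝ) + 1 ≤ P.bandwidth * (P.slotDuration - P.headerDelay)

open Classical in
/-- The content map after `C` got the status `c`. -/
noncomputable def NodeState.setContent (s : NodeState Tx Digest) (C : Chain Digest)
    (c : Content Tx) : Chain Digest → Content Tx :=
  Function.update s.content C c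

/-- One step of the system during slot `t`. Which steps are taken, and in which order, is up to the
adversary. -/
inductive Step (P : Protocol Tx Digest) (S : Setup) (t : ℕ) :
    State Tx Digest → State Tx Digest → Prop
  /-- Time passes. Header chains broadcast by honest nodes have to arrive in time, and contents are
  handled as soon as they can be. -/
  | tick (G : State Tx Digest) (x : ℝ) (h_le : G.now ≤ x) (h_end : x ≤ t * P.slotDuration)
      (h_due : ∀ q ∈ G.sent, q.2 + P.headerDelay < x → G.Delivered S q.1)
      (h_settled : ∀ i ∈ S.honest, (G.node i).Settled) :
      Step P S t G { G with now := x }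
  /-- An honest node receives a valid header chain, from the network or from the adversary. It adds
  the chain and its prefixes to its header tree, and broadcasts the chain. -/
  | header (G : State Tx Digest) (i : ℕ) (hi : i ∈ S.honest) (C : Chain Digest)
      (hC : C ∈ G.tree) :
      Step P S t G
        { G.setNode i
            { G.node i with
              headers := (G.node i).headers ∪ {C' | C' <+: C}
              history := (G.now, .header C) :: (G.node i).history } with
          sent := insert (C, G.now) G.sent }
  /-- The adversary hands any content to an honest node, irrespective of bandwidth. -/
  | push (G : State Tx Digest) (i : ℕ) (hi : i ∈ S.honest) (C : Chain Digest) (txs : List Tx) :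
      Step P S t G
        (G.setNode i
          { G.node i with
            deferred := insert (C, txs) (G.node i).deferred
            history := (G.now, .pushed C txs) :: (G.node i).history })
  /-- After the first `headerDelay` seconds of the slot, an honest node requests a block that its
  download rule picks, and receives the content from the repository, subject to its bandwidth. -/
  | download (G : State Tx Digest) (i : ℕ) (hi : i ∈ S.honest) (C : Chain Digest) (txs : List Tx)
      (h_time : ((t : ℝ) - 1) * P.slotDuration + P.headerDelay ≤ G.now)
      (h_due : G.NothingDue P S) (h_settled : (G.node i).Settled)
      (h_cap : (G.node i).HasCapacity P)
      (h_rule : some C ∈ P.rule.choices t (G.node i)) (h_repo : (C, txs) ∈ G.repo) :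
      Step P S t G
        (G.setNode i
          { G.node i with
            deferred := insert (C, txs) (G.node i).deferred
            downloads := (G.node i).downloads + 1
            history := (G.now, .downloaded C txs) :: (G.node i).history })
  /-- A received content that does not match the commitment in the header is dropped. -/
  | reject (G : State Tx Digest) (i : ℕ) (hi : i ∈ S.honest) (C : Chain Digest) (txs : List Tx)
      (h_mem : (C, txs) ∈ (G.node i).deferred) (h_ready : (G.node i).Ready C)
      (h_hash : ¬ Commits P.hash C txs) :
      Step P S t G
        (G.setNode i { G.node i with deferred := (G.node i).deferred \ {(C, txs)} })
  /-- A received content that matches the commitment, but is not semantically valid, marks the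
  block as invalid. -/
  | invalidate (G : State Tx Digest) (i : ℕ) (hi : i ∈ S.honest) (C : Chain Digest)
      (txs : List Tx) (best : Chain Digest)
      (h_mem : (C, txs) ∈ (G.node i).deferred) (h_ready : (G.node i).Ready C)
      (h_hash : Commits P.hash C txs)
      (h_valid : ¬ TxsValid P.txValid (chainTxs (G.node i).content C.dropLast) txs)
      (s : NodeState Tx Digest)
      (hs : s = { G.node i with
                  deferred := (G.node i).deferred \ {(C, txs)}
                  content := (G.node i).setContent C .invalid
                  best := best })
      (h_best : s.IsLongest best) :
      Step P S t G (G.setNode i s)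
  /-- A received content that matches the commitment and is semantically valid is adopted and
  uploaded; the node updates its longest downloaded chain (ties are broken by the adversary). -/
  | adopt (G : State Tx Digest) (i : ℕ) (hi : i ∈ S.honest) (C : Chain Digest)
      (txs : List Tx) (best : Chain Digest)
      (h_mem : (C, txs) ∈ (G.node i).deferred) (h_ready : (G.node i).Ready C)
      (h_hash : Commits P.hash C txs)
      (h_valid : TxsValid P.txValid (chainTxs (G.node i).content C.dropLast) txs)
      (s : NodeState Tx Digest)
      (hs : s = { G.node i with
                  deferred := (G.node i).deferred \ {(C, txs)}
                  content := (G.node i).setContent C (.known txs)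
                  best := best })
      (h_best : s.IsLongest best) :
      Step P S t G { G.setNode i s with repo := insert (C, txs) G.repo }
  /-- The adversary uploads a content that matches the commitment in the header. -/
  | upload (G : State Tx Digest) (C : Chain Digest) (txs : List Tx)
      (h_hash : Commits P.hash C txs) :
      Step P S t G { G with repo := insert (C, txs) G.repo }
  /-- The adversary produces a block from a present or past block production opportunity of a
  corrupt node, as often as it likes, on any valid chain with an earlier tip. -/
  | extend (G : State Tx Digest) (i r : ℕ) (C : Chain Digest) (txs : List Tx)
      (hC : C ∈ G.tree) (hi : i ∈ S.corruptLeaders r) (h_lt : tipTime C < r) (h_le : r ≤ t) :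
      Step P S t G { G with tree := insert (C ++ [⟨r, i, P.hash txs⟩]) G.tree }

/-- At the end of slot `t` node `i` has used up its bandwidth of that slot, or its download rule
(with ties broken by the adversary) makes no request, or requests an unavailable content. -/
def State.Exhausted (P : Protocol Tx Digest) (t : ℕ) (G : State Tx Digest) (i : ℕ) : Prop :=
  ¬ (G.node i).HasCapacity P ∨
    ∃ o ∈ P.rule.choices t (G.node i), ∀ C, o = some C → ∀ txs, (C, txs) ∉ G.repo

/-- Slot `t` is over. -/
structure State.SlotDone (P : Protocol Tx Digest) (S : Setup) (t : ℕ) (G : State Tx Digest) :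
    Prop where
  time : G.now = t * P.slotDuration
  due : G.NothingDue P S
  settled : ∀ i ∈ S.honest, (G.node i).Settled
  exhausted : ∀ i ∈ S.honest, G.Exhausted P t i

/-! ### Executions and runs -/

/-- An execution over the slots `1, …, T`: the numbers `(H_t, A_t)` of honest and of adversarial
nodes that are eligible to propose a block in slot `t`; slot `t` has index `t - 1`. -/
abbrev Execution (T : ℕ) := Fin T → ℕ × ℕ

/-- `H_t`. -/
def honestCount {T : ℕ} (E : Execution T) (t : ℕ) : ℕ :=
  if h : 1 ≤ t ∧ t ≤ T then (E ⟨t - 1, by omega⟩).1 else 0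

/-- `A_t`. -/
def adversarialCount {T : ℕ} (E : Execution T) (t : ℕ) : ℕ :=
  if h : 1 ≤ t ∧ t ≤ T then (E ⟨t - 1, by omega⟩).2 else 0

/-- Slot `t` is uniquely successful. -/
def UniquelySuccessful {T : ℕ} (E : Execution T) (t : ℕ) : Prop :=
  adversarialCount E t = 0 ∧ honestCount E t = 1

/-- The law of the execution: all `H_t` are Poisson with mean `(1 - β) ρ`, all `A_t` are Poisson
with mean `β ρ`, and all of them are independent. -/
noncomputable def executionLaw (ρ β : ℝ) (T : ℕ) : Measure (Execution T) :=
  Measure.pi fun _ =>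
    (poissonMeasure ((1 - β) * ρ).toNNReal).prod (poissonMeasure (β * ρ).toNNReal)

/-- A run of the protocol in the execution `E`, against some adversarial strategy. The run includes
all choices that are not determined by `E`: the number of nodes, the corrupted nodes (at most a
fraction `β`), the identities of the leaders, the pending transactions, and all the actions of the
adversary. -/
structure Run (P : Protocol Tx Digest) (β : ℝ) {T : ℕ} (E : Execution T) where
  setup : Setup
  disjoint : Disjoint setup.honest setup.corrupt
  corrupt_le : (setup.corrupt.card : ℝ) ≤ β * (setup.honest.card + setup.corrupt.card)
  honestLeaders_subset : ∀ t, setup.honestLeaders t ⊆ setup.honest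
  corruptLeaders_subset : ∀ t, setup.corruptLeaders t ⊆ setup.corrupt
  card_honestLeaders : ∀ t, (setup.honestLeaders t).card = honestCount E t
  card_corruptLeaders : ∀ t, (setup.corruptLeaders t).card = adversarialCount E t
  /-- `batch t i`: the pending transactions that node `i` is given at the beginning of slot `t` -/
  batch : ℕ → ℕ → List Tx
  /-- the number of steps in slot `t` -/
  steps : ℕ → ℕ
  /-- `trace t k`: the state after the first `k` steps of slot `t` -/
  trace : ℕ → ℕ → State Tx Digest
  /-- the state at the end of slot `t` -/
  endState : ℕ → State Tx Digest
  endState_zero : endState 0 = P.initialState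
  batch_new : ∀ t, 1 ≤ t → t ≤ T → ∀ i ∈ setup.honest, ∀ tx ∈ batch t i,
    tx ∉ ((endState (t - 1)).node i).bestTxs
  batch_valid : ∀ t, 1 ≤ t → t ≤ T → ∀ i ∈ setup.honest,
    TxsValid P.txValid ((endState (t - 1)).node i).bestTxs (batch t i)
  trace_zero : ∀ t, 1 ≤ t → t ≤ T →
    trace t 0 = (endState (t - 1)).beginSlot P setup t (batch t)
  trace_step : ∀ t, 1 ≤ t → t ≤ T → ∀ k < steps t,
    Step P setup t (trace t k) (trace t (k + 1))
  trace_end : ∀ t, 1 ≤ t → t ≤ T → trace t (steps t) = endState t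
  slotDone : ∀ t, 1 ≤ t → t ≤ T → (endState t).SlotDone P setup t

section Properties

variable {P : Protocol Tx Digest} {β : ℝ} {T : ℕ} {E : Execution T}

/-- The block proposed by honest node `p` in slot `t`. -/
def Run.proposal (R : Run P β E) (t p : ℕ) : Chain Digest :=
  (R.endState (t - 1)).newBlock P t p (R.batch t p)

/-- The blocks of the longest downloaded chain of node `i` at the end of slot `t` whose time slots
are at most `t - Tconf`, in the order of the chain. -/
def Run.confirmed (R : Run P β E) (Tconf i t : ℕ) : List (Chain Digest) :=
  ((R.endState t).node i).best.inits.filter fun C => tipTime C + Tconf ≤ t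

/-- The ledger of node `i` at the end of slot `t`. -/
def Run.log (R : Run P β E) (Tconf i t : ℕ) : List Tx :=
  blocksTxs ((R.endState t).node i).content (R.confirmed Tconf i t)

/-- Consistency of ledgers, both as chains of blocks and as lists of transactions. -/
def Run.LogPrefix (R : Run P β E) (Tconf i t j r : ℕ) : Prop :=
  R.confirmed Tconf i t <+: R.confirmed Tconf j r ∧ R.log Tconf i t <+: R.log Tconf j r

/-- All honest nodes have received the transaction `tx` before slot `t`: from slot `t` on, it is
among the pending transactions given to any honest node whose longest downloaded chain does not
contain it. -/
def Run.ReceivedBefore (R : Run P β E) (tx : Tx) (t : ℕ) : Prop :=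
  ∀ r, 1 ≤ r → t ≤ r → r ≤ T → ∀ i ∈ R.setup.honest,
    tx ∈ ((R.endState (r - 1)).node i).bestTxs ∨ tx ∈ R.batch r i

end Properties

/-- `MaxDL_K`: against every adversarial strategy, the block proposed in any uniquely successful
slot is downloaded by all honest nodes within the first `K` contents that they download in that
slot. -/
def MaxDL (P : Protocol Tx Digest) (β : ℝ) {T : ℕ} (E : Execution T) (K : ℕ) : Prop :=
  ∀ R : Run P β E, ∀ t, 1 ≤ t → t ≤ T → UniquelySuccessful E t →
    ∀ p ∈ R.setup.honestLeaders t, ∀ i ∈ R.setup.honest,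
      ∃ k ≤ R.steps t, ((R.trace t k).node i).downloads ≤ K ∧
        ((R.trace t k).node i).Downloaded (R.proposal t p)

/-- Safety: against every adversarial strategy, of any two ledgers of honest nodes one is a prefix
of the other. -/
def Safe (P : Protocol Tx Digest) (Tconf : ℕ) (β : ℝ) {T : ℕ} (E : Execution T) : Prop :=
  ∀ R : Run P β E, ∀ t ≤ T, ∀ r ≤ T, ∀ i ∈ R.setup.honest, ∀ j ∈ R.setup.honest,
    R.LogPrefix Tconf i t j r ∨ R.LogPrefix Tconf j r i t

/-- Liveness with parameter `Tlive`: against every adversarial strategy, a transaction received by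
all honest nodes before slot `t` is in all their ledgers from slot `t + Tlive` on. -/
def Live (P : Protocol Tx Digest) (Tconf Tlive : ℕ) (β : ℝ) {T : ℕ} (E : Execution T) : Prop :=
  ∀ R : Run P β E, ∀ (tx : Tx) (t : ℕ), R.ReceivedBefore tx t →
    ∀ r, t + Tlive ≤ r → r ≤ T → ∀ i ∈ R.setup.honest, tx ∈ R.log Tconf i r

/-- A function of the security parameter is negligible. -/
def Negligible (f : ℕ → ℝ) : Prop :=
  ∀ n : ℕ, 0 < n → ∃ κ₀ : ℕ, ∀ κ : ℕ, κ₀ < κ → f κ < 1 / (κ : ℝ) ^ n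

end PoSLC

open PoSLC

/-! The proof splits into a deterministic part about runs and a probabilistic part about a walk,
linked by the notion of a pivot. The walk moves by +1 in a uniquely successful slot, by 0 in an
empty slot and by -1 in any other ("contested") slot. A pivot is a uniquely successful slot `t` such
that the walk is higher at every `s ≥ t` than at every `r < t`.

Deterministic part. Under `MaxDL` the block of a uniquely successful slot is downloaded by every
honest node before the slot ends. Hence the minimal height of the honest chains grows by at least
one in each such slot (`length_best_add`). Suppose that some honest longest chain misses the block
of a pivot `t`. By induction, all later blocks of uniquely successful slots are built on the pivot
block, so this chain contains no block of a uniquely successful slot from `t` on. Block times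
increase strictly along a chain; therefore, beyond a block that all honest nodes had at some time `r
< t`, the chain gains at most one block per contested slot (`length_le_of_avoids`). The honest
chains meanwhile gain one block per uniquely successful slot, and the pivot inequality makes the
chain too short to be longest. So pivot blocks are never lost (`proposal_prefix_best`). A pivot
among the latest `Tconf` slots pins the confirmed prefix, which gives safety. A pivot after the
arrival of a transaction includes it, which gives liveness.

Probabilistic part. The rate condition gives the walk positive drift, in the exponential form `a =
E[z ^ step] < 1` for some `z < 1`. With high probability the walk rises over all intervals of length
at least `m` (`longRise`), so only intervals shorter than `m` can spoil a pivot. A run of `2L + 1`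
uniquely successful slots with fluctuations at most `L` up to distance `m` on both sides absorbs
those (`isPivot_of_mem_localPivot`). This local event has probability bounded below independently of
`m` and depends only on `2L + 1 + 2m` slots, so `n` disjoint blocks give `n` independent trials.
Taking `m` and `n` of order `κ + ln T` makes the failure probability exponentially small, and `n`
blocks of length of order `m` form a window of quadratic length. -/

namespace PoSLC

section Protocol

variable {Tx : Type u} {Digest : Type v}

/-! ### Local states -/

theorem chainTxs_congr {c c' : Chain Digest → Content Tx} {C : Chain Digest}
    (h : ∀ C', C' <+: C → c C' = c' C') : chainTxs c C = chainTxs c' C := by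
  unfold chainTxs blocksTxs
  refine List.flatMap_congr fun D hD => ?_
  rw [h D (List.mem_inits _ _ |>.1 hD)]

/-- The known contents of a local state match their headers and are valid, and `best` is a longest
downloaded chain. -/
structure NodeState.Consistent (P : Protocol Tx Digest) (s : NodeState Tx Digest) : Prop where
  genesis : s.content [] = .known P.genesisTxs
  mem_headers : ∀ C txs, s.content C = .known txs → C ∈ s.headers
  prefix_known : ∀ C txs, s.content C = .known txs →
    ∀ C', C' <+: C → ∃ txs', s.content C' = .known txs'
  commits : ∀ C txs, C ≠ [] → s.content C = .known txs → Commits P.hash C txs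
  valid : ∀ C txs, C ≠ [] → s.content C = .known txs →
    TxsValid P.txValid (chainTxs s.content C.dropLast) txs
  longest : s.IsLongest s.best

/-- The information order on local states. -/
structure NodeState.Le (s s' : NodeState Tx Digest) : Prop where
  headers : s.headers ⊆ s'.headers
  content : ∀ C txs, s.content C = .known txs → s'.content C = .known txs

section

variable {P : Protocol Tx Digest}

theorem Commits.unique (hinj : Function.Injective P.hash) {C : Chain Digest} {l l' : List Tx}
    (h : Commits P.hash C l) (h' : Commits P.hash C l') : l = l' := by
  obtain ⟨a, ha, hl⟩ := h
  obtain ⟨b, hb, hl'⟩ := h'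
  rw [ha, Option.some.injEq] at hb
  subst hb
  exact hinj (hl.symm.trans hl')

theorem Commits.ne_nil {C : Chain Digest} {l : List Tx} (h : Commits P.hash C l) : C ≠ [] := by
  rintro rfl
  obtain ⟨a, ha, -⟩ := h
  simp at ha

end

namespace NodeState

variable {P : Protocol Tx Digest} {s s' s'' : NodeState Tx Digest}

theorem Le.refl (s : NodeState Tx Digest) : s.Le s := ⟨subset_rfl, fun _ _ h => h⟩

theorem Le.trans (h : s.Le s') (h' : s'.Le s'') : s.Le s'' :=
  ⟨h.headers.trans h'.headers, fun C txs hC => h'.content C txs (h.content C txs hC)⟩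

theorem Le.downloaded (h : s.Le s') {C : Chain Digest} (hC : s.Downloaded C) :
    s'.Downloaded C :=
  ⟨h.headers hC.1, hC.2.imp fun _ => h.content C _⟩

theorem Le.length_best (h : s.Le s') (hs : s.Consistent P) (hs' : s'.Consistent P) :
    s.best.length ≤ s'.best.length :=
  hs'.longest.2 _ (h.downloaded hs.longest.1)

theorem Consistent.downloaded_of_prefix (hs : s.Consistent P) {C C' : Chain Digest}
    (hC : s.Downloaded C) (h : C' <+: C) : s.Downloaded C' := by
  obtain ⟨-, txs, htxs⟩ := hC
  obtain ⟨txs', h'⟩ := hs.prefix_known C txs htxs C' h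
  exact ⟨hs.mem_headers _ _ h', txs', h'⟩

/-- Two consistent local states agree on the contents that both know. -/
theorem Consistent.content_eq (hinj : Function.Injective P.hash) (hs : s.Consistent P)
    (hs' : s'.Consistent P) {C : Chain Digest} (h : s.Downloaded C) (h' : s'.Downloaded C) :
    s.content C = s'.content C := by
  obtain ⟨-, l, hl⟩ := h
  obtain ⟨-, l', hl'⟩ := h'
  by_cases hC : C = []
  · subst hC
    rw [hs.genesis, hs'.genesis]
  · rw [hl, hl', Commits.unique hinj (hs.commits C l hC hl) (hs'.commits C l' hC hl')]

theorem Ready.dropLast_known {C : Chain Digest} (h : s.Ready C) (hC : C ≠ []) {C' : Chain Digest}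
    (h' : C' <+: C.dropLast) : ∃ txs, s.content C' = .known txs := by
  refine h.2 C' (h'.trans (List.dropLast_prefix C)) ?_
  rintro rfl
  have := h'.length_le
  have := List.length_pos_iff.2 hC
  simp only [List.length_dropLast] at *
  omega

/-- Known contents are preserved by `Le`, and readiness means that all proper prefixes were known
already. So the ledger against which a content was validated is the same in both states. -/
theorem Consistent.of_le (hs : s.Consistent P) (h : s.Le s')
    (hnew : ∀ C txs, s'.content C = .known txs → s.content C = .known txs ∨
      (C ≠ [] ∧ s.Ready C ∧ Commits P.hash C txs ∧
        TxsValid P.txValid (chainTxs s.content C.dropLast) txs))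
    (hbest : s'.IsLongest s'.best) : s'.Consistent P := by
  have congr : ∀ C : Chain Digest, (∀ C', C' <+: C → ∃ txs, s.content C' = .known txs) →
      chainTxs s'.content C = chainTxs s.content C := by
    intro C hC
    refine chainTxs_congr fun C' hC' => ?_
    obtain ⟨l, hl⟩ := hC C' hC'
    rw [hl, h.content _ _ hl]
  refine ⟨h.content _ _ hs.genesis, ?_, ?_, ?_, ?_, hbest⟩
  · intro C l hl
    rcases hnew C l hl with h' | ⟨-, h', -⟩
    · exact h.headers (hs.mem_headers _ _ h')
    · exact h.headers h'.1
  · intro C l hl C' hC'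
    rcases hnew C l hl with h' | ⟨-, h', -⟩
    · exact (hs.prefix_known _ _ h' C' hC').imp fun _ => h.content _ _
    · by_cases he : C' = C
      · exact ⟨l, he ▸ hl⟩
      · exact (h'.2 C' hC' he).imp fun _ => h.content _ _
  · intro C l hC hl
    rcases hnew C l hl with h' | ⟨-, -, h', -⟩
    · exact hs.commits _ _ hC h'
    · exact h'
  · intro C l hC hl
    rcases hnew C l hl with h' | ⟨-, hr, -, h'⟩
    · rw [congr]
      · exact hs.valid _ _ hC h'
      · exact fun C' hC' => hs.prefix_known _ _ h' C' (hC'.trans (List.dropLast_prefix C))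
    · rw [congr]
      · exact h'
      · exact fun C' hC' => hr.dropLast_known hC hC'

theorem Consistent.of_content_eq (hs : s.Consistent P) (hh : s.headers ⊆ s'.headers)
    (hc : s'.content = s.content) (hb : s'.best = s.best) : s'.Consistent P ∧ s.Le s' := by
  have hle : s.Le s' := ⟨hh, fun C l h => hc ▸ h⟩
  refine ⟨hs.of_le hle (fun C l h => .inl (hc ▸ h)) ⟨hb ▸ hle.downloaded hs.longest.1, ?_⟩, hle⟩
  rintro C ⟨-, l, hl⟩
  rw [hc] at hl
  exact hb ▸ hs.longest.2 C ⟨hs.mem_headers _ _ hl, l, hl⟩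

theorem setContent_self (s : NodeState Tx Digest) (C : Chain Digest) (c : Content Tx) :
    s.setContent C c C = c := by
  simp [setContent]

theorem setContent_of_ne (s : NodeState Tx Digest) {C D : Chain Digest} (c : Content Tx)
    (h : D ≠ C) : s.setContent C c D = s.content D := by
  simp [setContent, h]

theorem Consistent.adopt (hinj : Function.Injective P.hash) (hs : s.Consistent P)
    {C : Chain Digest} {txs : List Tx} (h_ready : s.Ready C) (h_hash : Commits P.hash C txs)
    (h_valid : TxsValid P.txValid (chainTxs s.content C.dropLast) txs)
    (hh : s'.headers = s.headers) (hc : s'.content = s.setContent C (.known txs))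
    (hb : s'.IsLongest s'.best) : s'.Consistent P ∧ s.Le s' := by
  have hC := Commits.ne_nil h_hash
  have hle : s.Le s' := by
    refine ⟨hh.ge, fun D l hl => ?_⟩
    by_cases hD : D = C
    · subst hD
      rw [hc, setContent_self,
        Commits.unique hinj h_hash (hs.commits D l hC hl)]
    · rw [hc, setContent_of_ne _ _ hD, hl]
  refine ⟨hs.of_le hle (fun D l hl => ?_) hb, hle⟩
  by_cases hD : D = C
  · subst hD
    rw [hc, setContent_self, Content.known.injEq] at hl
    subst hl
    exact .inr ⟨hC, h_ready, h_hash, h_valid⟩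
  · rw [hc, setContent_of_ne _ _ hD] at hl
    exact .inl hl

/-- The danger is that a downloaded block gets lost by being marked invalid. As the commitment is
binding, the offending content would equal the adopted one, which is valid against the same ledger.
-/
theorem Consistent.invalidate (hinj : Function.Injective P.hash) (hs : s.Consistent P)
    {C : Chain Digest} {txs : List Tx} (h_hash : Commits P.hash C txs)
    (h_valid : ¬ TxsValid P.txValid (chainTxs s.content C.dropLast) txs)
    (hh : s'.headers = s.headers) (hc : s'.content = s.setContent C .invalid)
    (hb : s'.IsLongest s'.best) : s'.Consistent P ∧ s.Le s' := by
  have hC := Commits.ne_nil h_hash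
  have hle : s.Le s' := by
    refine ⟨hh.ge, fun D l hl => ?_⟩
    by_cases hD : D = C
    · subst hD
      rw [Commits.unique hinj h_hash (hs.commits D l hC hl)] at h_valid
      exact absurd (hs.valid D l hC hl) h_valid
    · rw [hc, setContent_of_ne _ _ hD, hl]
  refine ⟨hs.of_le hle (fun D l hl => .inl ?_) hb, hle⟩
  by_cases hD : D = C
  · subst hD
    rw [hc, setContent_self] at hl
    cases hl
  · rwa [hc, setContent_of_ne _ _ hD] at hl

end NodeState

/-! ### Global states -/

/-- Invariant of the global state during slot `t`, where `prop r i` is the block that honest node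
`i` proposes in slot `r`. -/
structure State.Valid (P : Protocol Tx Digest) (S : Setup) (prop : ℕ → ℕ → Chain Digest) (t : ℕ)
    (G : State Tx Digest) : Prop where
  node : ∀ i, (G.node i).Consistent P
  headers_subset : ∀ i, (G.node i).headers ⊆ G.tree
  tree : ∀ C h, C ++ [h] ∈ G.tree → C ∈ G.tree ∧ tipTime C < h.time ∧ h.time ≤ t ∧
    ((S.corruptLeaders h.time).Nonempty ∨
      ∃ i ∈ S.honestLeaders h.time, C ++ [h] = prop h.time i)

@[simp]
theorem tipTime_nil : tipTime ([] : Chain Digest) = 0 := rfl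

@[simp]
theorem tipTime_append_singleton (C : Chain Digest) (h : Header Digest) :
    tipTime (C ++ [h]) = h.time := by
  simp [tipTime]

namespace State

variable {P : Protocol Tx Digest} {S : Setup} {prop : ℕ → ℕ → Chain Digest} {t : ℕ}
  {G G' : State Tx Digest}

theorem Valid.mem_of_prefix (hG : G.Valid P S prop t) {C C' : Chain Digest} (hC : C ∈ G.tree)
    (h : C' <+: C) : C' ∈ G.tree := by
  induction C using List.reverseRecOn with
  | nil => rwa [List.prefix_nil.1 h]
  | append_singleton C a ih =>
    rcases List.prefix_concat_iff.1 h with rfl | h'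
    · simpa using hC
    · exact ih (hG.tree C a hC).1 h'

theorem Valid.tipTime_le (hG : G.Valid P S prop t) {C : Chain Digest} (hC : C ∈ G.tree) :
    tipTime C ≤ t := by
  rcases List.eq_nil_or_concat C with rfl | ⟨D, a, rfl⟩
  · simp
  · simpa using (hG.tree D a (by simpa using hC)).2.2.1

theorem Valid.tipTime_mono (hG : G.Valid P S prop t) {C C' : Chain Digest} (hC : C ∈ G.tree)
    (h : C' <+: C) : tipTime C' ≤ tipTime C := by
  induction C using List.reverseRecOn with
  | nil => rw [List.prefix_nil.1 h]
  | append_singleton C a ih =>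
    rcases List.prefix_concat_iff.1 h with rfl | h'
    · simp
    · have := hG.tree C a hC
      have := ih this.1 h'
      rw [tipTime_append_singleton]
      omega

theorem Valid.best_mem (hG : G.Valid P S prop t) (i : ℕ) : (G.node i).best ∈ G.tree :=
  hG.headers_subset i (hG.node i).longest.1.1

theorem Valid.update (hG : G.Valid P S prop t) {i : ℕ} {s : NodeState Tx Digest}
    (hs : s.Consistent P ∧ (G.node i).Le s) (hh : s.headers ⊆ G.tree)
    (hn : G'.node = Function.update G.node i s) (ht : G'.tree = G.tree) :
    G'.Valid P S prop t ∧ ∀ j, (G.node j).Le (G'.node j) := by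
  refine ⟨⟨fun j => ?_, fun j => ?_, ?_⟩, fun j => ?_⟩
  · by_cases h : j = i
    · subst h; simpa [hn] using hs.1
    · simpa [hn, h] using hG.node j
  · by_cases h : j = i
    · subst h; simpa [hn, ht] using hh
    · simpa [hn, ht, h] using hG.headers_subset j
  · rw [ht]; exact hG.tree
  · by_cases h : j = i
    · subst h; simpa [hn] using hs.2
    · simpa [hn, h] using NodeState.Le.refl _

theorem Valid.of_eq (hG : G.Valid P S prop t) (hn : G'.node = G.node) (ht : G'.tree = G.tree) :
    G'.Valid P S prop t ∧ ∀ j, (G.node j).Le (G'.node j) := by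
  refine ⟨⟨?_, ?_, ?_⟩, ?_⟩
  · rw [hn]; exact hG.node
  · rw [hn, ht]; exact hG.headers_subset
  · rw [ht]; exact hG.tree
  · rw [hn]; exact fun j => .refl _

theorem Valid.step (hinj : Function.Injective P.hash) (hG : G.Valid P S prop t)
    (h : Step P S t G G') : G'.Valid P S prop t ∧ ∀ j, (G.node j).Le (G'.node j) := by
  cases h with
  | tick x => exact hG.of_eq rfl rfl
  | header i hi C hC =>
    refine hG.update ((hG.node i).of_content_eq (s' := { G.node i with
        headers := (G.node i).headers ∪ {C' | C' <+: C}
        history := (G.now, .header C) :: (G.node i).history })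
      Set.subset_union_left rfl rfl) ?_ rfl rfl
    exact Set.union_subset (hG.headers_subset i) fun C' hC' => hG.mem_of_prefix hC hC'
  | push i hi C txs =>
    exact hG.update ((hG.node i).of_content_eq (s' := { G.node i with
      deferred := insert (C, txs) (G.node i).deferred
      history := (G.now, .pushed C txs) :: (G.node i).history }) subset_rfl rfl rfl)
      (hG.headers_subset i) rfl rfl
  | download i hi C txs =>
    exact hG.update ((hG.node i).of_content_eq (s' := { G.node i with
      deferred := insert (C, txs) (G.node i).deferred
      downloads := (G.node i).downloads + 1
      history := (G.now, .downloaded C txs) :: (G.node i).history }) subset_rfl rfl rfl)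
      (hG.headers_subset i) rfl rfl
  | reject i hi C txs =>
    exact hG.update ((hG.node i).of_content_eq (s' := { G.node i with
      deferred := (G.node i).deferred \ {(C, txs)} }) subset_rfl rfl rfl)
      (hG.headers_subset i) rfl rfl
  | invalidate i hi C txs best _ _ h_hash h_valid s hs h_best =>
    have hb : s.best = best := by rw [hs]
    exact hG.update ((hG.node i).invalidate hinj h_hash h_valid (by rw [hs]) (by rw [hs])
      (hb ▸ h_best)) (by rw [hs]; exact hG.headers_subset i) rfl rfl
  | adopt i hi C txs best _ h_ready h_hash h_valid s hs h_best =>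
    have hb : s.best = best := by rw [hs]
    exact hG.update ((hG.node i).adopt hinj h_ready h_hash h_valid (by rw [hs]) (by rw [hs])
      (hb ▸ h_best)) (by rw [hs]; exact hG.headers_subset i) rfl rfl
  | upload C txs h_hash => exact hG.of_eq rfl rfl
  | extend i r C txs hC hi h_lt h_le =>
    refine ⟨⟨hG.node, fun j => (hG.headers_subset j).trans (Set.subset_insert _ _), ?_⟩,
      fun j => .refl _⟩
    intro D a hD
    rcases hD with hD | hD
    · obtain ⟨rfl, ha⟩ := List.append_inj' hD rfl
      obtain rfl := List.singleton_injective ha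
      exact ⟨.inr hC, h_lt, h_le, .inl ⟨i, hi⟩⟩
    · exact ⟨.inr (hG.tree D a hD).1, (hG.tree D a hD).2⟩

theorem Valid.beginSlot {batch : ℕ → List Tx} (hG : G.Valid P S prop t)
    (hprop : ∀ i, prop (t + 1) i = G.newBlock P (t + 1) i (batch i)) :
    (G.beginSlot P S (t + 1) batch).Valid P S prop (t + 1) ∧
      ∀ j, (G.node j).Le ((G.beginSlot P S (t + 1) batch).node j) := by
  have key : ∀ j, ((G.beginSlot P S (t + 1) batch).node j).Consistent P ∧
      (G.node j).Le ((G.beginSlot P S (t + 1) batch).node j) := fun j =>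
    (hG.node j).of_content_eq (s' := { G.node j with downloads := 0 }) subset_rfl rfl rfl
  refine ⟨⟨fun j => (key j).1, fun j => (hG.headers_subset j).trans Set.subset_union_left, ?_⟩,
    fun j => (key j).2⟩
  intro D a hD
  rcases hD with hD | ⟨i, ⟨hi, hb, hlt⟩, hD⟩
  · obtain ⟨h1, h2, h3, h4⟩ := hG.tree D a hD
    exact ⟨.inl h1, h2, by omega, h4⟩
  · have hD' := hD
    obtain ⟨rfl, ha⟩ := List.append_inj' hD rfl
    obtain rfl := List.singleton_injective ha
    exact ⟨.inl hb, hlt, le_rfl, .inr ⟨i, hi, hD'.trans (hprop i).symm⟩⟩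

theorem valid_initialState (P : Protocol Tx Digest) (S : Setup)
    (prop : ℕ → ℕ → Chain Digest) : P.initialState.Valid P S prop 0 := by
  have known : ∀ (i : ℕ) C l, (P.initialState.node i).content C = .known l → C = [] := by
    intro i C l h
    by_contra hC
    simp [Protocol.initialState, hC] at h
  refine ⟨fun i => ⟨by simp [Protocol.initialState], ?_, ?_, ?_, ?_, ?_⟩, fun i => ?_, ?_⟩
  · intro C l h
    rw [known i C l h]
    simp [Protocol.initialState]
  · intro C l h C' hC'
    rw [known i C l h, List.prefix_nil] at hC'
    subst hC'
    exact ⟨P.genesisTxs, by simp [Protocol.initialState]⟩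
  · exact fun C l hC h => absurd (known i C l h) hC
  · exact fun C l hC h => absurd (known i C l h) hC
  · refine ⟨⟨by simp [Protocol.initialState], P.genesisTxs, by simp [Protocol.initialState]⟩, ?_⟩
    rintro C ⟨-, l, h⟩
    rw [known i C l h]
    simp
  · exact subset_rfl
  · intro C a h
    simp [Protocol.initialState] at h

end State

/-! ### Runs -/

namespace Run

variable {P : Protocol Tx Digest} {β : ℝ} {T : ℕ} {E : Execution T}

/-- The local state of node `i` at the end of slot `t`. -/
def nodeAt (R : Run P β E) (t i : ℕ) : NodeState Tx Digest := (R.endState t).node i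

/-- The last clause compares intermediate states with the end of the slot: `MaxDL` provides the
download at some moment within the slot, and it has to persist. -/
theorem valid_trace (hinj : Function.Injective P.hash) (R : Run P β E) {t : ℕ} (ht : 1 ≤ t)
    (htT : t ≤ T) (hprev : (R.endState (t - 1)).Valid P R.setup R.proposal (t - 1)) :
    (R.endState t).Valid P R.setup R.proposal t ∧
      (∀ j, (R.nodeAt (t - 1) j).Le (R.nodeAt t j)) ∧
      ∀ k ≤ R.steps t, ∀ j, ((R.trace t k).node j).Le (R.nodeAt t j) := by
  obtain ⟨t, rfl⟩ : ∃ t', t = t' + 1 := ⟨t - 1, by omega⟩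
  simp only [Nat.add_sub_cancel] at *
  have h0 := hprev.beginSlot (batch := R.batch (t + 1)) fun i => rfl
  have hz : R.trace (t + 1) 0 = (R.endState t).beginSlot P R.setup (t + 1) (R.batch (t + 1)) :=
    R.trace_zero (t + 1) ht htT
  rw [← hz] at h0
  have hvalid : ∀ k ≤ R.steps (t + 1),
      (R.trace (t + 1) k).Valid P R.setup R.proposal (t + 1) := by
    intro k
    induction k with
    | zero => exact fun _ => h0.1
    | succ k ih =>
      exact fun hk => ((ih (by omega)).step hinj (R.trace_step (t + 1) ht htT k (by omega))).1
  have hmono : ∀ k ≤ R.steps (t + 1), ∀ j,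
      ((R.trace (t + 1) k).node j).Le (R.nodeAt (t + 1) j) := by
    intro k hk
    -- Induction backwards from the end of the slot, since the final state is the fixed one.
    induction hk using Nat.decreasingInduction with
    | self =>
      intro j
      rw [R.trace_end (t + 1) ht htT]
      exact .refl _
    | of_succ k hk ih =>
      exact fun j => (((hvalid k hk.le).step hinj
        (R.trace_step (t + 1) ht htT k hk)).2 j).trans (ih j)
  refine ⟨?_, fun j => (h0.2 j).trans (hmono 0 (Nat.zero_le _) j), hmono⟩
  rw [← R.trace_end (t + 1) ht htT]
  exact hvalid _ le_rfl

theorem valid_endState (hinj : Function.Injective P.hash) (R : Run P β E) {t : ℕ} (ht : t ≤ T) :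
    (R.endState t).Valid P R.setup R.proposal t := by
  induction t with
  | zero => rw [R.endState_zero]; exact State.valid_initialState _ _ _
  | succ t ih => exact (R.valid_trace hinj (by omega) ht (ih (by omega))).1

theorem nodeAt_le (hinj : Function.Injective P.hash) (R : Run P β E) {r s : ℕ} (hrs : r ≤ s)
    (hs : s ≤ T) (i : ℕ) : (R.nodeAt r i).Le (R.nodeAt s i) := by
  induction s, hrs using Nat.le_induction with
  | base => exact .refl _
  | succ s hrs ih =>
    exact (ih (by omega)).trans
      ((R.valid_trace hinj (by omega) hs (R.valid_endState hinj (by omega))).2.1 i)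

theorem consistent (hinj : Function.Injective P.hash) (R : Run P β E) {t : ℕ} (ht : t ≤ T)
    (i : ℕ) : (R.nodeAt t i).Consistent P :=
  (R.valid_endState hinj ht).node i

theorem length_best_mono (hinj : Function.Injective P.hash) (R : Run P β E) {r s : ℕ}
    (hrs : r ≤ s) (hs : s ≤ T) (i : ℕ) :
    (R.nodeAt r i).best.length ≤ (R.nodeAt s i).best.length :=
  (R.nodeAt_le hinj hrs hs i).length_best (R.consistent hinj (hrs.trans hs) i)
    (R.consistent hinj hs i)

/-- Under `MaxDL` the block of a uniquely successful slot is downloaded at the end of that slot. -/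
theorem downloaded_proposal (hinj : Function.Injective P.hash) (R : Run P β E) {K : ℕ}
    (hE : MaxDL P β E K) {t s : ℕ} (ht : 1 ≤ t) (hts : t ≤ s) (hs : s ≤ T)
    (hu : UniquelySuccessful E t) {p i : ℕ} (hp : p ∈ R.setup.honestLeaders t)
    (hi : i ∈ R.setup.honest) : (R.nodeAt s i).Downloaded (R.proposal t p) := by
  have htT := hts.trans hs
  obtain ⟨k, hk, -, h⟩ := hE R t ht htT hu p hp i hi
  have h' := (R.valid_trace hinj ht htT (R.valid_endState hinj (by omega))).2.2 k hk i
  exact (R.nodeAt_le hinj hts hs i).downloaded (h'.downloaded h)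

theorem exists_leader (R : Run P β E) {t : ℕ} (hu : UniquelySuccessful E t) :
    ∃ p ∈ R.setup.honest, R.setup.honestLeaders t = {p} := by
  obtain ⟨p, hp⟩ := Finset.card_eq_one.1 ((R.card_honestLeaders t).trans hu.2)
  exact ⟨p, R.honestLeaders_subset t (by simp [hp]), hp⟩

/-- A block carries the slot of its production. Without corrupt leaders and with a single honest
one, that slot has room for one block only, whichever chain it appears in. -/
theorem eq_proposal (hinj : Function.Injective P.hash) (R : Run P β E) {s p : ℕ} (hs : s ≤ T)
    {C : Chain Digest} {h : Header Digest} (hC : C ++ [h] ∈ (R.endState s).tree)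
    (hu : UniquelySuccessful E h.time) (hp : R.setup.honestLeaders h.time = {p}) :
    C ++ [h] = R.proposal h.time p := by
  obtain ⟨-, -, -, h' | ⟨i, hi, h'⟩⟩ := (R.valid_endState hinj hs).tree C h hC
  · have := R.card_corruptLeaders h.time
    rw [hu.1] at this
    exact absurd this h'.card_pos.ne'
  · rw [hp, Finset.mem_singleton] at hi
    exact hi ▸ h'

end Run

end Protocol

/-! ### Pivots -/

open Classical in
/-- The contribution of slot `t` to the walk of an execution: `1` if the slot is uniquely
successful, `0` if no node is eligible, and `-1` otherwise. -/
noncomputable def slotStep {T : ℕ} (E : Execution T) (t : ℕ) : ℤ :=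
  if UniquelySuccessful E t then 1
  else if honestCount E t = 0 ∧ adversarialCount E t = 0 then 0 else -1

/-- The walk of an execution. -/
noncomputable def walk {T : ℕ} (E : Execution T) (t : ℕ) : ℤ :=
  ∑ s ∈ Finset.Ioc 0 t, slotStep E s

/-- In every interval of slots around `t`, the uniquely successful slots outnumber the other slots
with eligible nodes. -/
structure IsPivot {T : ℕ} (E : Execution T) (t : ℕ) : Prop where
  pos : 1 ≤ t
  unique : UniquelySuccessful E t
  walk_lt : ∀ r < t, ∀ s, t ≤ s → s ≤ T → walk E r < walk E s

theorem walk_succ {T : ℕ} (E : Execution T) (t : ℕ) :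
    walk E (t + 1) = walk E t + slotStep E (t + 1) := by
  simp [walk, Finset.sum_Ioc_succ_top]

/-- The number of uniquely successful slots up to slot `t`. -/
noncomputable def uniqueCount {T : ℕ} (E : Execution T) (t : ℕ) : ℤ :=
  ∑ s ∈ Finset.Ioc 0 t, max (slotStep E s) 0

theorem uniqueCount_succ {T : ℕ} (E : Execution T) (t : ℕ) :
    uniqueCount E (t + 1) = uniqueCount E t + max (slotStep E (t + 1)) 0 := by
  simp [uniqueCount, Finset.sum_Ioc_succ_top]

/-- The number of slots up to slot `t` that are neither empty nor uniquely successful. -/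
noncomputable def contestedCount {T : ℕ} (E : Execution T) (t : ℕ) : ℤ :=
  uniqueCount E t - walk E t

theorem contestedCount_succ {T : ℕ} (E : Execution T) (t : ℕ) :
    contestedCount E (t + 1) = contestedCount E t + max (-slotStep E (t + 1)) 0 := by
  rw [contestedCount, contestedCount, uniqueCount_succ, walk_succ]
  omega

theorem contestedCount_mono {T : ℕ} (E : Execution T) : Monotone (contestedCount E) :=
  monotone_nat_of_le_succ fun t => by
    rw [contestedCount_succ]
    have := le_max_right (-slotStep E (t + 1)) 0
    omega

section Pivot

variable {Tx : Type u} {Digest : Type v} {P : Protocol Tx Digest} {β : ℝ} {T K : ℕ}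
  {E : Execution T}

/-! ### Growth of honest chains and persistence of pivot blocks. -/

namespace Run

/-- The leader of a uniquely successful slot extends a chain at least as long as the common lower
bound, and everyone downloads the result. The bound must hold for all honest nodes at once because
any of them may be the next leader. -/
theorem length_best_add (hinj : Function.Injective P.hash) (R : Run P β E)
    (hE : MaxDL P β E K) {r s : ℕ} (hrs : r ≤ s) (hs : s ≤ T) {m : ℤ}
    (hm : ∀ i ∈ R.setup.honest, m ≤ (R.nodeAt r i).best.length) :
    ∀ i ∈ R.setup.honest,
      m + (uniqueCount E s - uniqueCount E r) ≤ (R.nodeAt s i).best.length := by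
  induction s, hrs using Nat.le_induction with
  | base => simpa using hm
  | succ s hrs ih =>
    intro i hi
    rw [uniqueCount_succ]
    have ih := ih (by omega)
    by_cases hu : UniquelySuccessful E (s + 1)
    · obtain ⟨p, hp, hl⟩ := R.exists_leader hu
      have hd := R.downloaded_proposal hinj hE (by omega) le_rfl hs hu (p := p)
        (by simp [hl]) hi
      have h1 := (R.consistent hinj hs i).longest.2 _ hd
      have h2 := ih p hp
      simp only [proposal, State.newBlock, List.length_append, List.length_singleton,
        Nat.add_sub_cancel] at h1
      simp only [nodeAt] at h1 h2 ⊢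
      simp only [slotStep, hu, if_true]
      omega
    · have h1 := R.length_best_mono hinj (Nat.le_succ s) hs i
      have h2 := ih i hi
      have h3 : slotStep E (s + 1) ≤ 0 := by
        simp only [slotStep, hu, if_false]
        split_ifs <;> simp
      rw [max_eq_right h3]
      simp only [Nat.succ_eq_add_one] at h1
      omega

theorem slotStep_eq_neg_one (hinj : Function.Injective P.hash) (R : Run P β E) {s : ℕ}
    (hs : s ≤ T) {C : Chain Digest} {h : Header Digest}
    (hC : C ++ [h] ∈ (R.endState s).tree) (hu : ¬ UniquelySuccessful E h.time) :
    slotStep E h.time = -1 := by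
  have : ¬ (honestCount E h.time = 0 ∧ adversarialCount E h.time = 0) := by
    rintro ⟨h1, h2⟩
    rw [← R.card_honestLeaders, Finset.card_eq_zero] at h1
    rw [← R.card_corruptLeaders, Finset.card_eq_zero] at h2
    obtain ⟨-, -, -, h' | ⟨i, hi, -⟩⟩ := (R.valid_endState hinj hs).tree C h hC
    · simp [h2] at h'
    · simp [h1] at hi
  simp [slotStep, hu, this]

/-- A chain without blocks of uniquely successful slots from slot `t` on is outgrown by the honest
chains, up to contested slots. -/
theorem length_le_of_avoids (hinj : Function.Injective P.hash) (R : Run P β E)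
    (hE : MaxDL P β E K) {t s : ℕ} (ht : 1 ≤ t) (hs : s ≤ T) {C : Chain Digest}
    (hC : C ∈ (R.endState s).tree)
    (hu : ∀ D h, D ++ [h] <+: C → UniquelySuccessful E h.time → h.time < t) :
    ∃ r < t, r ≤ tipTime C ∧ ∀ i ∈ R.setup.honest, (C.length : ℤ) ≤
      (R.nodeAt r i).best.length + (contestedCount E (tipTime C) - contestedCount E r) := by
  have hv := R.valid_endState hinj hs
  induction C using List.reverseRecOn with
  | nil => exact ⟨0, ht, le_rfl, fun i _ => by simp⟩
  | append_singleton C a ih =>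
    obtain ⟨hC', hlt, hle, -⟩ := hv.tree C a hC
    -- If the tip is from a uniquely successful slot, all honest nodes had it at the end of that
    -- slot, which serves as `r`. Otherwise the tip is charged to its own contested slot.
    by_cases ha : UniquelySuccessful E a.time
    · refine ⟨a.time, hu C a List.prefix_rfl ha, by simp, fun i hi => ?_⟩
      obtain ⟨p, hp, hl⟩ := R.exists_leader ha
      have hd := R.downloaded_proposal hinj hE (by omega) le_rfl (by omega) ha (p := p)
        (by simp [hl]) hi
      rw [← R.eq_proposal hinj hs hC ha hl] at hd
      have := (R.consistent hinj (by omega) i).longest.2 _ hd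
      simp only [tipTime_append_singleton, sub_self, add_zero]
      exact_mod_cast this
    · obtain ⟨r, hrt, hr, h⟩ := ih hC' fun D h hD => hu D h (hD.trans (List.prefix_append _ _))
      refine ⟨r, hrt, by simp; omega, fun i hi => ?_⟩
      have h1 := h i hi
      have h2 := R.slotStep_eq_neg_one hinj hs hC ha
      obtain ⟨b, hb⟩ : ∃ b, a.time = b + 1 := ⟨a.time - 1, by omega⟩
      have h3 := contestedCount_succ E b
      -- The parent's time is strictly smaller, so the contested slot of the tip has not been
      -- charged before.
      have h4 := contestedCount_mono E (show tipTime C ≤ b by omega)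
      rw [← hb, h2] at h3
      simp only [tipTime_append_singleton, List.length_append, List.length_singleton]
      push_cast
      norm_num at h3
      omega

/-- The block of a pivot stays in the longest downloaded chains of all honest nodes. -/
theorem proposal_prefix_best (hinj : Function.Injective P.hash) (R : Run P β E)
    (hE : MaxDL P β E K) {t p : ℕ} (ht : IsPivot E t) (hp : R.setup.honestLeaders t = {p}) :
    ∀ s, t ≤ s → s ≤ T → ∀ i ∈ R.setup.honest,
      R.proposal t p <+: (R.nodeAt s i).best := by
  intro s
  induction s using Nat.strong_induction_on with
  | _ s ih =>
  intro hts hs i hi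
  by_contra hcon
  have hv := R.valid_endState hinj hs
  have hmem : (R.nodeAt s i).best ∈ (R.endState s).tree := hv.best_mem i
  -- A block in this chain from a uniquely successful slot at or after `t` would bring the pivot
  -- block with it: it either is that block or extends a chain that contains it.
  obtain ⟨r, hrt, hr, h⟩ := R.length_le_of_avoids hinj hE ht.pos hs hmem (t := t) (by
    intro D a hD ha
    by_contra hlt
    have hDm := hv.mem_of_prefix hmem hD
    obtain ⟨q, hq, hl⟩ := R.exists_leader ha
    have heq := R.eq_proposal hinj hs hDm ha hl
    have hle := (hv.tree D a hDm).2.2.1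
    rcases (not_lt.1 hlt).eq_or_lt with h' | h'
    · refine hcon ?_
      rw [h'] at hp ⊢
      obtain rfl := Finset.singleton_injective (hp.symm.trans hl)
      exact heq ▸ hD
    -- The leader `q` built on its chain from the end of the preceding slot, to which the induction
    -- hypothesis applies.
    · refine hcon ((ih (a.time - 1) (by omega) (by omega) (by omega) q hq).trans ?_)
      have hpre : (R.nodeAt (a.time - 1) q).best <+: R.proposal a.time q :=
        List.prefix_append _ _
      exact hpre.trans (heq ▸ hD))
  have hle : tipTime (R.nodeAt s i).best ≤ s := hv.tipTime_le hmem
  -- The honest gain from `r` to `s` is at most the contested count in between, so the walk does not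
  -- rise from `r` to `s`, contrary to the pivot property.
  have h1 := R.length_best_add hinj hE (show r ≤ s by omega) hs
    (m := (R.nodeAt s i).best.length -
      (contestedCount E (tipTime (R.nodeAt s i).best) - contestedCount E r))
    (fun j hj => by have := h j hj; omega) i hi
  have h2 := contestedCount_mono E hle
  have h3 := ht.walk_lt r hrt s hts hs
  simp only [contestedCount] at h1 h2
  omega

end Run

/-! ### Ledgers -/

theorem mem_blocksTxs {c : Chain Digest → Content Tx} {l : List (Chain Digest)} {tx : Tx} :
    tx ∈ blocksTxs c l ↔ ∃ C ∈ l, tx ∈ (c C).txs := by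
  simp [blocksTxs]

theorem blocksTxs_prefix {c c' : Chain Digest → Content Tx} {l l' : List (Chain Digest)}
    (h : l <+: l') (hc : ∀ C ∈ l, c C = c' C) : blocksTxs c l <+: blocksTxs c' l' := by
  obtain ⟨m, rfl⟩ := h
  refine ⟨blocksTxs c' m, ?_⟩
  unfold blocksTxs
  rw [List.flatMap_append, List.flatMap_congr fun C hC => by rw [hc C hC]]

theorem inits_concat {α : Type*} (l : List α) (a : α) :
    (l ++ [a]).inits = l.inits ++ [l ++ [a]] := by
  induction l with
  | nil => simp
  | cons b l ih => simp [ih]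

theorem inits_prefix {α : Type*} {l l' : List α} (h : l <+: l') : l.inits <+: l'.inits := by
  obtain ⟨m, rfl⟩ := h
  induction m using List.reverseRecOn with
  | nil => simp
  | append_singleton m a ih =>
    rw [← List.append_assoc, inits_concat]
    exact ih.trans (List.prefix_append _ _)

theorem filter_inits_eq {α : Type*} {l l' : List α} (h : l <+: l') {q : List α → Bool}
    (hq : ∀ k, k <+: l' → l <+: k → q k = false) : l'.inits.filter q = l.inits.filter q := by
  obtain ⟨m, rfl⟩ := h
  induction m using List.reverseRecOn with
  | nil => simp
  | append_singleton m a ih =>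
    have h1 := ih fun k hk => hq k (hk.trans (by simp [← List.append_assoc]))
    have h2 := hq (l ++ (m ++ [a])) List.prefix_rfl (List.prefix_append _ _)
    rw [← List.append_assoc] at h2 ⊢
    rw [inits_concat, List.filter_append, h1, List.filter_singleton, h2]
    simp

/-- As `q` passes to prefixes, the filter keeps an initial segment of `l.inits`: either everything,
or nothing is lost by dropping the last entry. In the application `q` bounds the tip time, which is
monotone along valid chains. -/
theorem filter_inits_prefix {α : Type*} {l l' : List α} (h : l <+: l') {q q' : List α → Bool}
    (hq : ∀ k, k <+: l → q k = true → ∀ k', k' <+: k → q k' = true)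
    (hqq' : ∀ k, k <+: l → q k = true → q' k = true) :
    l.inits.filter q <+: l'.inits.filter q' := by
  by_cases hl : q l = true
  · have h1 : ∀ k ∈ l.inits, q k = true := fun k hk =>
      hq l List.prefix_rfl hl k ((List.mem_inits _ _).1 hk)
    have h2 : ∀ k ∈ l.inits, q' k = true := fun k hk =>
      hqq' k ((List.mem_inits _ _).1 hk) (h1 k hk)
    rw [List.filter_eq_self.2 h1, ← List.filter_eq_self.2 h2]
    exact (inits_prefix h).filter q'
  · induction l using List.reverseRecOn with
    | nil => simp_all
    | append_singleton l a ih =>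
      have hpre : l <+: l ++ [a] := List.prefix_append _ _
      rw [inits_concat, List.filter_append, List.filter_singleton, (Bool.not_eq_true _).mp hl]
      simp only [cond_false, List.append_nil]
      by_cases hl' : q l = true
      · have h1 : ∀ k ∈ l.inits, q k = true := fun k hk =>
          hq l hpre hl' k ((List.mem_inits _ _).1 hk)
        have h2 : ∀ k ∈ l.inits, q' k = true := fun k hk =>
          hqq' k (((List.mem_inits _ _).1 hk).trans hpre) (h1 k hk)
        rw [List.filter_eq_self.2 h1, ← List.filter_eq_self.2 h2]
        exact (inits_prefix (hpre.trans h)).filter q'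
      · exact ih (hpre.trans h) (fun k hk => hq k (hk.trans hpre))
          (fun k hk => hqq' k (hk.trans hpre)) hl'

namespace Run

theorem mem_confirmed (R : Run P β E) {Tconf i t : ℕ} {C : Chain Digest} :
    C ∈ R.confirmed Tconf i t ↔ C <+: (R.nodeAt t i).best ∧ tipTime C + Tconf ≤ t := by
  simp [confirmed, nodeAt]

theorem tipTime_proposal (R : Run P β E) (t p : ℕ) : tipTime (R.proposal t p) = t := by
  simp [proposal, State.newBlock]

/-- Both nodes hold the pivot block, and everything above it is too recent to be confirmed at time
`t`. Hence the ledger at `t` is read off from the chain of the pivot block, which is common to both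
nodes. -/
theorem logPrefix_of_pivot (hinj : Function.Injective P.hash) (R : Run P β E)
    (hE : MaxDL P β E K) {Tconf t r i j p : ℕ} (htr : t ≤ r) (hr : r ≤ T)
    (hi : i ∈ R.setup.honest) (hj : j ∈ R.setup.honest) (hp : IsPivot E p) (hpt : p ≤ t)
    (htp : t < p + Tconf) : R.LogPrefix Tconf i t j r := by
  obtain ⟨q, -, hq⟩ := R.exists_leader hp.unique
  have h1 := R.proposal_prefix_best hinj hE hp hq t hpt (htr.trans hr) i hi
  have h2 := R.proposal_prefix_best hinj hE hp hq r (hpt.trans htr) hr j hj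
  have hconf : R.confirmed Tconf i t <+: R.confirmed Tconf j r := by
    have hv := R.valid_endState hinj (htr.trans hr)
    have hmem := hv.mem_of_prefix (hv.best_mem i) h1
    have h3 : R.confirmed Tconf i t =
        (R.proposal p q).inits.filter fun C => decide (tipTime C + Tconf ≤ t) := by
      refine filter_inits_eq h1 fun D hD hB => ?_
      have := hv.tipTime_mono (hv.mem_of_prefix (hv.best_mem i) hD) hB
      rw [tipTime_proposal] at this
      simp
      omega
    rw [h3]
    refine filter_inits_prefix h2 (fun D hD hqD D' hD' => ?_) fun D _ hqD => ?_
    · have := hv.tipTime_mono (hv.mem_of_prefix hmem hD) hD'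
      simp only [decide_eq_true_eq] at hqD ⊢
      omega
    · simp only [decide_eq_true_eq] at hqD ⊢
      omega
  refine ⟨hconf, blocksTxs_prefix hconf fun C hC => ?_⟩
  have hC' := (R.mem_confirmed.1 (hconf.subset hC)).1
  have hC := (R.mem_confirmed.1 hC).1
  have ci := R.consistent hinj (htr.trans hr) i
  have cj := R.consistent hinj hr j
  exact ci.content_eq hinj cj (ci.downloaded_of_prefix ci.longest.1 hC)
    (cj.downloaded_of_prefix cj.longest.1 hC')

theorem confirmed_eq_nil (R : Run P β E) {Tconf i t : ℕ} (h : t < Tconf) :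
    R.confirmed Tconf i t = [] := by
  refine List.eq_nil_iff_forall_not_mem.2 fun C hC => ?_
  have := (R.mem_confirmed.1 hC).2
  omega

/-- A pivot confirms all transactions that were pending before it. -/
theorem mem_log_of_pivot (hinj : Function.Injective P.hash) (R : Run P β E)
    (hE : MaxDL P β E K) {Tconf t r i p : ℕ} {tx : Tx} (htx : R.ReceivedBefore tx t)
    (hr : r ≤ T) (hi : i ∈ R.setup.honest) (hp : IsPivot E p) (htp : t ≤ p)
    (hpr : p + Tconf ≤ r) : tx ∈ R.log Tconf i r := by
  obtain ⟨q, hq, hl⟩ := R.exists_leader hp.unique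
  have hpT : p ≤ T := by omega
  have hpos := hp.pos
  have hpre := R.proposal_prefix_best hinj hE hp hl r (by omega) hr i hi
  have hv := R.valid_endState hinj hr
  have ci := R.consistent hinj hr i
  have cq := R.consistent hinj (show p - 1 ≤ T by omega) q
  have hbest : (R.nodeAt (p - 1) q).best <+: R.proposal p q := List.prefix_append _ _
  rw [log, mem_blocksTxs]
  -- The transaction is either below the pivot block or in it. In both cases its block has time at
  -- most `p`, hence is confirmed.
  rcases htx p hpos htp hpT q hq with h | h
  · rw [NodeState.bestTxs, chainTxs, mem_blocksTxs] at h
    obtain ⟨C, hC, hCtx⟩ := h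
    rw [List.mem_inits] at hC
    have hC' := hC.trans (hbest.trans hpre)
    have htime := hv.tipTime_mono (hv.mem_of_prefix (hv.best_mem i) hpre) (hC.trans hbest)
    rw [tipTime_proposal] at htime
    refine ⟨C, R.mem_confirmed.2 ⟨hC', by omega⟩, ?_⟩
    have := cq.content_eq hinj ci (cq.downloaded_of_prefix cq.longest.1 hC)
      (ci.downloaded_of_prefix ci.longest.1 hC')
    simp only [nodeAt] at this
    rwa [← this]
  · refine ⟨R.proposal p q, R.mem_confirmed.2 ⟨hpre, by rw [tipTime_proposal]; exact hpr⟩, ?_⟩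
    obtain ⟨-, l, hl⟩ := ci.downloaded_of_prefix ci.longest.1 hpre
    have h1 := ci.commits _ l (by simp [proposal, State.newBlock]) hl
    have h2 : Commits P.hash (R.proposal p q) (R.batch p q) :=
      ⟨⟨p, q, P.hash (R.batch p q)⟩, by simp [proposal, State.newBlock], rfl⟩
    rw [Commits.unique hinj h1 h2] at hl
    simp only [nodeAt] at hl
    rw [hl]
    exact h

end Run

/-! ### Safety and liveness from pivots in all windows. -/

theorem safe_of_pivots (hinj : Function.Injective P.hash) (hE : MaxDL P β E K) {Tconf W : ℕ}
    (hW : W ≤ Tconf) (h : ∀ w, w + W ≤ T → ∃ p, w < p ∧ p ≤ w + W ∧ IsPivot E p) :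
    Safe P Tconf β E := by
  intro R
  have key : ∀ t r, t ≤ r → r ≤ T → ∀ i ∈ R.setup.honest, ∀ j ∈ R.setup.honest,
      R.LogPrefix Tconf i t j r := by
    intro t r htr hr i hi j hj
    -- Before slot `Tconf` ledgers are empty, even without genesis. Afterwards the window of `W`
    -- slots that ends in `t` lies within the execution.
    by_cases ht : t < Tconf
    · simp [Run.LogPrefix, Run.log, R.confirmed_eq_nil ht, blocksTxs]
    · obtain ⟨p, h1, h2, hp⟩ := h (t - W) (by omega)
      exact R.logPrefix_of_pivot hinj hE htr hr hi hj hp (by omega) (by omega)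
  intro t ht r hr i hi j hj
  rcases le_total t r with h' | h'
  · exact .inl (key t r h' hr i hi j hj)
  · exact .inr (key r t h' ht j hj i hi)

theorem live_of_pivots (hinj : Function.Injective P.hash) (hE : MaxDL P β E K)
    {Tconf Tlive W : ℕ} (hW : Tconf + W ≤ Tlive)
    (h : ∀ w, w + W ≤ T → ∃ p, w < p ∧ p ≤ w + W ∧ IsPivot E p) :
    Live P Tconf Tlive β E := by
  intro R tx t htx r hr hrT i hi
  obtain ⟨p, h1, h2, hp⟩ := h t (by omega)
  exact R.mem_log_of_pivot hinj hE htx hrT hi hp h1.le (by omega)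

end Pivot

/-! ### Product measures on executions -/

section Product

variable {T : ℕ}

/-- The contribution of a slot with `e.1` honest and `e.2` adversarial leaders to the walk. -/
def leaderStep (e : ℕ × ℕ) : ℤ := if e = (1, 0) then 1 else if e = (0, 0) then 0 else -1

theorem slotStep_succ (E : Execution T) (i : Fin T) :
    slotStep E (i + 1) = leaderStep (E i) := by
  have h : 1 ≤ (i : ℕ) + 1 ∧ (i : ℕ) + 1 ≤ T := ⟨by omega, i.2⟩
  have h1 : honestCount E (i + 1) = (E i).1 := by simp [honestCount, h]
  have h2 : adversarialCount E (i + 1) = (E i).2 := by simp [adversarialCount, h]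
  simp only [slotStep, UniquelySuccessful, h1, h2, leaderStep, Prod.ext_iff]
  simp only [and_comm]

theorem uniquelySuccessful_succ {E : Execution T} {i : Fin T} (h : E i = (1, 0)) :
    UniquelySuccessful E (i + 1) := by
  have h' : 1 ≤ (i : ℕ) + 1 ∧ (i : ℕ) + 1 ≤ T := ⟨by omega, i.2⟩
  simp [UniquelySuccessful, honestCount, adversarialCount, h', h]

/-- The indices of the slots `r + 1, …, s`. -/
def slotRange (T r s : ℕ) : Finset (Fin T) := Finset.univ.filter fun i => r ≤ i ∧ i < s

theorem mem_slotRange {r s : ℕ} {i : Fin T} : i ∈ slotRange T r s ↔ r ≤ i ∧ i < s := by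
  simp [slotRange]

theorem slotRange_succ {r s : ℕ} (hrs : r ≤ s) (hs : s < T) :
    slotRange T r (s + 1) = Finset.cons ⟨s, hs⟩ (slotRange T r s) (by simp [mem_slotRange]) := by
  ext i
  simp only [mem_slotRange, Finset.mem_cons, Fin.ext_iff]
  omega

theorem slotRange_self (r : ℕ) : slotRange T r r = ∅ := by
  ext i
  simp [mem_slotRange]

theorem card_slotRange {r s : ℕ} (hrs : r ≤ s) (hs : s ≤ T) : (slotRange T r s).card = s - r := by
  induction s, hrs using Nat.le_induction with
  | base => simp [slotRange_self]
  | succ s hrs ih =>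
    rw [slotRange_succ hrs hs, Finset.card_cons, ih (by omega)]
    omega

theorem disjoint_slotRange {r s r' s' : ℕ} (h : s ≤ r') :
    Disjoint (slotRange T r s) (slotRange T r' s') := by
  rw [Finset.disjoint_left]
  intro i hi hi'
  rw [mem_slotRange] at hi hi'
  omega

theorem slotRange_subset {r s r' s' : ℕ} (h : r' ≤ r) (h' : s ≤ s') :
    slotRange T r s ⊆ slotRange T r' s' := by
  intro i hi
  rw [mem_slotRange] at *
  omega

theorem walk_eq_add_sum (E : Execution T) {r s : ℕ} (hrs : r ≤ s) (hs : s ≤ T) :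
    walk E s = walk E r + ∑ i ∈ slotRange T r s, leaderStep (E i) := by
  induction s, hrs using Nat.le_induction with
  | base => simp [slotRange_self]
  | succ s hrs ih =>
    rw [slotRange_succ hrs hs, Finset.sum_cons, walk_succ, ih (by omega),
      ← slotStep_succ E ⟨s, hs⟩]
    ring

/-! ### Exponential moments and independence. -/

variable (ν : Measure (ℕ × ℕ))

theorem integrable_of_forall_mem_Icc {α : Type*} [MeasurableSpace α] [Countable α]
    [MeasurableSingletonClass α] {μ : Measure α} [IsFiniteMeasure μ] {f : α → ℝ} {c : ℝ}
    (hf : ∀ x, 0 ≤ f x ∧ f x ≤ c) : Integrable f μ :=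
  .of_bound (measurable_of_countable f).aestronglyMeasurable c
    (ae_of_all _ fun x => by rw [Real.norm_of_nonneg (hf x).1]; exact (hf x).2)

theorem leaderStep_zpow_mem {z : ℝ} (hz : 0 < z) (hz1 : z < 1) (e : ℕ × ℕ) :
    0 ≤ z ^ leaderStep e ∧ z ^ leaderStep e ≤ z⁻¹ := by
  have h1 := one_lt_inv₀ hz |>.2 hz1
  refine ⟨by positivity, ?_⟩
  unfold leaderStep
  split_ifs <;> simp <;> linarith

theorem integral_zpow_nonneg {z : ℝ} (hz : 0 < z) : 0 ≤ ∫ e, z ^ leaderStep e ∂ν :=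
  integral_nonneg fun _ => by positivity

variable [IsProbabilityMeasure ν]

/-- Exponential tail bound for the increments of the walk. -/
theorem measureReal_walk_le {z : ℝ} (hz : 0 < z) (hz1 : z < 1) {r s : ℕ} (hrs : r ≤ s)
    (hs : s ≤ T) (b : ℕ) :
    (Measure.pi fun _ : Fin T => ν).real {E : Execution T | walk E s + b ≤ walk E r} ≤
      z ^ b * (∫ e, z ^ leaderStep e ∂ν) ^ (s - r) := by
  classical
  set μ := Measure.pi fun _ : Fin T => ν
  -- The factor 1 outside the range lets the product run over all slots, as the product formula for
  -- integrals requires.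
  set f : Fin T → ℕ × ℕ → ℝ := fun i e =>
    if i ∈ slotRange T r s then z ^ leaderStep e else 1 with hf
  have hprod : ∀ E : Execution T, ∏ i, f i (E i) = z ^ (walk E s - walk E r) := by
    intro E
    rw [walk_eq_add_sum E hrs hs, add_sub_cancel_left, Finset.prod_ite_mem, Finset.univ_inter]
    induction slotRange T r s using Finset.cons_induction with
    | empty => simp
    | cons i S hi ih => rw [Finset.prod_cons, Finset.sum_cons, ih, zpow_add₀ hz.ne']
  have hint : ∫ E, ∏ i, f i (E i) ∂μ = (∫ e, z ^ leaderStep e ∂ν) ^ (s - r) := by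
    rw [integral_fintype_prod_eq_prod, ← card_slotRange hrs hs, ← Finset.prod_const,
      ← Finset.univ_inter (slotRange T r s), ← Finset.prod_ite_mem]
    refine Finset.prod_congr rfl fun i _ => ?_
    by_cases hi : i ∈ slotRange T r s <;> simp [hf, hi]
  have hf1 : ∀ i e, 0 ≤ f i e ∧ f i e ≤ z⁻¹ := by
    intro i e
    by_cases hi : i ∈ slotRange T r s
    · simpa [hf, hi] using leaderStep_zpow_mem hz hz1 e
    · simpa [hf, hi] using (one_le_inv₀ hz).2 hz1.le
  have hmarkov := mul_meas_ge_le_integral_of_nonneg (μ := μ)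
    (f := fun E : Execution T => ∏ i, f i (E i))
    (ae_of_all _ fun E => Finset.prod_nonneg fun i _ => (hf1 i _).1)
    (.fintype_prod fun i => integrable_of_forall_mem_Icc (hf1 i)) ((z ^ b)⁻¹)
  rw [hint, inv_mul_le_iff₀ (by positivity)] at hmarkov
  -- Since `z < 1`, a fall by at least `b` makes the product at least `z⁻ᵇ`, so Markov's inequality
  -- applies.
  refine (measureReal_mono fun E hE => ?_).trans hmarkov
  rw [Set.mem_ofPred_eq, hprod, ← zpow_natCast, ← zpow_neg]
  refine zpow_le_zpow_right_of_le_one₀ hz hz1.le ?_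
  rw [Set.mem_ofPred_eq] at hE
  linarith

/-- This puts events into the form required by independence of subfamilies. Measurability is
automatic because the sample spaces are countable. -/
theorem eq_preimage_of_dependsOn {S : Finset (Fin T)} {A : Set (Execution T)}
    (hA : DependsOn (· ∈ A) (S : Set (Fin T))) :
    A = (fun E (i : S) => E i) ⁻¹' ((fun E (i : S) => E i) '' A) := by
  refine (Set.subset_preimage_image _ _).antisymm fun E hE => ?_
  obtain ⟨E', hE', h⟩ := hE
  exact (hA fun i hi => congrFun h ⟨i, hi⟩).mp hE'

/-- Events that depend on disjoint sets of slots are independent. -/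
theorem measureReal_inter_of_dependsOn {S S' : Finset (Fin T)} (h : Disjoint S S')
    {A A' : Set (Execution T)} (hA : DependsOn (· ∈ A) (S : Set (Fin T)))
    (hA' : DependsOn (· ∈ A') (S' : Set (Fin T))) :
    (Measure.pi fun _ : Fin T => ν).real (A ∩ A') =
      (Measure.pi fun _ : Fin T => ν).real A * (Measure.pi fun _ : Fin T => ν).real A' := by
  have hind : iIndepFun (fun (i : Fin T) (E : Execution T) => E i)
      (Measure.pi fun _ : Fin T => ν) :=
    iIndepFun_pi (X := fun _ e => e) fun _ => aemeasurable_id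
  have := (hind.indepFun_finset S S' h fun i => measurable_pi_apply i).measure_inter_preimage_eq_mul
    _ _ (Set.to_countable ((fun E (i : S) => E i) '' A)).measurableSet
    (Set.to_countable ((fun E (i : S') => E i) '' A')).measurableSet
  rw [← eq_preimage_of_dependsOn hA, ← eq_preimage_of_dependsOn hA'] at this
  simp only [measureReal_def, this, ENNReal.toReal_mul]

theorem DependsOn.compl {S : Set (Fin T)} {A : Set (Execution T)}
    (hA : DependsOn (· ∈ A) S) : DependsOn (· ∈ Aᶜ) S := fun _ _ h =>
  congrArg Not (hA h)

theorem DependsOn.inter {S : Set (Fin T)} {A B : Set (Execution T)}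
    (hA : DependsOn (· ∈ A) S) (hB : DependsOn (· ∈ B) S) : DependsOn (· ∈ A ∩ B) S :=
  fun _ _ h => congrArg₂ And (hA h) (hB h)

theorem DependsOn.of_subset {S S' : Set (Fin T)} {A : Set (Execution T)}
    (hA : DependsOn (· ∈ A) S) (h : S ⊆ S') : DependsOn (· ∈ A) S' :=
  fun _ _ hE => hA fun i hi => hE i (h hi)

/-! ### Local pivots -/

/-- The slots `u + 1, …, u + l` are uniquely successful. -/
def uniqueRun (T u l : ℕ) : Set (Execution T) :=
  {E | ∀ i : Fin T, u ≤ i → i < u + l → E i = (1, 0)}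

/-- Within distance `m` to the right of slot `v`, the walk falls by at most `L`. -/
def smallFall (T v m L : ℕ) : Set (Execution T) :=
  {E | ∀ k ≤ m, walk E v ≤ walk E (v + k) + L}

/-- Within distance `m` to the left of slot `v`, the walk exceeds its value at `v` by at most
`L`. -/
def smallRise (T v m L : ℕ) : Set (Execution T) :=
  {E | ∀ k ≤ m, walk E (v - k) ≤ walk E v + L}

/-- A run of uniquely successful slots with small fluctuations of the walk on both sides. -/
def localPivot (T u m L : ℕ) : Set (Execution T) :=
  uniqueRun T u (2 * L + 1) ∩ (smallRise T u m L ∩ smallFall T (u + (2 * L + 1)) m L)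

theorem dependsOn_uniqueRun (u l : ℕ) :
    DependsOn (· ∈ uniqueRun T u l) (slotRange T u (u + l) : Set (Fin T)) := by
  refine fun E E' h => propext (forall_congr' fun i => ?_)
  refine forall_congr' fun h1 => forall_congr' fun h2 => ?_
  rw [h i (by simp [mem_slotRange, h1, h2])]

theorem dependsOn_smallFall {v m : ℕ} (L : ℕ) (hv : v + m ≤ T) :
    DependsOn (· ∈ smallFall T v m L) (slotRange T v (v + m) : Set (Fin T)) := by
  refine fun E E' h => propext (forall_congr' fun k => forall_congr' fun hk => ?_)
  rw [walk_eq_add_sum E (Nat.le_add_right v k) (by omega),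
    walk_eq_add_sum E' (Nat.le_add_right v k) (by omega),
    Finset.sum_congr rfl fun i hi => by
      rw [h i (slotRange_subset le_rfl (by omega) hi)]]
  constructor <;> intro <;> linarith

theorem dependsOn_smallRise {v m : ℕ} (L : ℕ) (hv : v ≤ T) :
    DependsOn (· ∈ smallRise T v m L) (slotRange T (v - m) v : Set (Fin T)) := by
  refine fun E E' h => propext (forall_congr' fun k => forall_congr' fun hk => ?_)
  rw [walk_eq_add_sum E (Nat.sub_le v k) (by omega),
    walk_eq_add_sum E' (Nat.sub_le v k) (by omega),
    Finset.sum_congr rfl fun i hi => by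
      rw [h i (slotRange_subset (by omega) le_rfl hi)]]
  constructor <;> intro <;> linarith

theorem dependsOn_localPivot {u m : ℕ} (L : ℕ) (hT : u + (2 * L + 1) + m ≤ T) :
    DependsOn (· ∈ localPivot T u m L)
      (slotRange T (u - m) (u + (2 * L + 1) + m) : Set (Fin T)) := by
  refine DependsOn.inter (DependsOn.of_subset (dependsOn_uniqueRun _ _) ?_)
    (DependsOn.inter (DependsOn.of_subset (dependsOn_smallRise L (by omega)) ?_)
      (DependsOn.of_subset (dependsOn_smallFall L hT) ?_)) <;>
  exact Finset.coe_subset.2 (slotRange_subset (by omega) (by omega))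

theorem measureReal_uniqueRun {u l : ℕ} (h : u + l ≤ T) :
    (Measure.pi fun _ : Fin T => ν).real (uniqueRun T u l) = ν.real {(1, 0)} ^ l := by
  classical
  have h1 : uniqueRun T u l =
      Set.univ.pi fun i => if i ∈ slotRange T u (u + l) then {(1, 0)} else Set.univ := by
    ext E
    simp only [uniqueRun, Set.mem_ofPred_eq, Set.mem_univ_pi]
    refine forall_congr' fun i => ?_
    by_cases hi : i ∈ slotRange T u (u + l)
    · have := mem_slotRange.1 hi
      simp [hi, this]
    · have := mt mem_slotRange.2 hi
      simp only [hi, if_false, Set.mem_univ, iff_true]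
      exact fun h1 h2 => absurd ⟨h1, h2⟩ this
  rw [h1, measureReal_def, Measure.pi_pi, ENNReal.toReal_prod]
  simp only [apply_ite ν, measure_univ, apply_ite ENNReal.toReal, ENNReal.toReal_one]
  rw [Finset.prod_ite_mem, Finset.univ_inter, Finset.prod_const,
    card_slotRange (Nat.le_add_right u l) h, Nat.add_sub_cancel_left, measureReal_def]

theorem sum_geom_le {a : ℝ} (ha : 0 ≤ a) (ha1 : a < 1) (n : ℕ) :
    ∑ k ∈ Finset.range n, a ^ k ≤ (1 - a)⁻¹ := by
  rw [← tsum_geometric_of_lt_one ha ha1]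
  exact (summable_geometric_of_lt_one ha ha1).sum_le_tsum _ fun _ _ => by positivity

/-! ### Probability that a window has no local pivot. -/

section Bounds

variable {z : ℝ}

/-- Union bound over `k`, summed as a geometric series. The bound does not involve `m`, so `L` can
be a constant. -/
theorem measureReal_smallFall_compl (hz : 0 < z) (hz1 : z < 1)
    (ha : ∫ e, z ^ leaderStep e ∂ν < 1) {v m L : ℕ} (h : v + m ≤ T) :
    (Measure.pi fun _ : Fin T => ν).real (smallFall T v m L)ᶜ ≤
      z ^ L * (1 - ∫ e, z ^ leaderStep e ∂ν)⁻¹ := by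
  calc _ ≤ (Measure.pi fun _ : Fin T => ν).real
        (⋃ k ∈ Finset.range (m + 1), {E | walk E (v + k) + L ≤ walk E v}) := by
        refine measureReal_mono (fun E hE => ?_) (measure_ne_top _ _)
        simp only [smallFall, Set.mem_compl_iff, Set.mem_ofPred_eq, not_forall, not_le] at hE
        obtain ⟨k, hk, hE⟩ := hE
        simp only [Set.mem_iUnion, Set.mem_ofPred_eq, Finset.mem_range]
        exact ⟨k, by omega, hE.le⟩
    _ ≤ ∑ k ∈ Finset.range (m + 1), (Measure.pi fun _ : Fin T => ν).real
          {E | walk E (v + k) + L ≤ walk E v} := measureReal_biUnion_finset_le _ _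
    _ ≤ ∑ k ∈ Finset.range (m + 1), z ^ L * (∫ e, z ^ leaderStep e ∂ν) ^ k := by
        refine Finset.sum_le_sum fun k hk => ?_
        rw [Finset.mem_range] at hk
        simpa using measureReal_walk_le ν hz hz1 (Nat.le_add_right v k) (by omega) L
    _ ≤ _ := by
        rw [← Finset.mul_sum]
        gcongr
        exact sum_geom_le (integral_zpow_nonneg ν hz) ha _

theorem measureReal_smallRise_compl (hz : 0 < z) (hz1 : z < 1)
    (ha : ∫ e, z ^ leaderStep e ∂ν < 1) {v m L : ℕ} (hm : m ≤ v) (h : v ≤ T) :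
    (Measure.pi fun _ : Fin T => ν).real (smallRise T v m L)ᶜ ≤
      z ^ L * (1 - ∫ e, z ^ leaderStep e ∂ν)⁻¹ := by
  calc _ ≤ (Measure.pi fun _ : Fin T => ν).real
        (⋃ k ∈ Finset.range (m + 1), {E | walk E v + L ≤ walk E (v - k)}) := by
        refine measureReal_mono (fun E hE => ?_) (measure_ne_top _ _)
        simp only [smallRise, Set.mem_compl_iff, Set.mem_ofPred_eq, not_forall, not_le] at hE
        obtain ⟨k, hk, hE⟩ := hE
        simp only [Set.mem_iUnion, Set.mem_ofPred_eq, Finset.mem_range]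
        exact ⟨k, by omega, hE.le⟩
    _ ≤ ∑ k ∈ Finset.range (m + 1), (Measure.pi fun _ : Fin T => ν).real
          {E | walk E v + L ≤ walk E (v - k)} := measureReal_biUnion_finset_le _ _
    _ ≤ ∑ k ∈ Finset.range (m + 1), z ^ L * (∫ e, z ^ leaderStep e ∂ν) ^ k := by
        refine Finset.sum_le_sum fun k hk => ?_
        rw [Finset.mem_range] at hk
        have := measureReal_walk_le ν hz hz1 (Nat.sub_le v k) h L
        rwa [Nat.sub_sub_self (by omega)] at this
    _ ≤ _ := by
        rw [← Finset.mul_sum]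
        gcongr
        exact sum_geom_le (integral_zpow_nonneg ν hz) ha _

/-- The two fluctuation events fail with probability at most 1/4 each, and they depend on slots
disjoint from those of the run. -/
theorem le_measureReal_localPivot (hz : 0 < z) (hz1 : z < 1)
    (ha : ∫ e, z ^ leaderStep e ∂ν < 1) {u m L : ℕ}
    (hL : z ^ L * (1 - ∫ e, z ^ leaderStep e ∂ν)⁻¹ ≤ 1 / 4) (hm : m ≤ u)
    (hT : u + (2 * L + 1) + m ≤ T) :
    ν.real {(1, 0)} ^ (2 * L + 1) / 2 ≤
      (Measure.pi fun _ : Fin T => ν).real (localPivot T u m L) := by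
  set μ := Measure.pi fun _ : Fin T => ν
  set R := smallRise T u m L ∩ smallFall T (u + (2 * L + 1)) m L with hR
  have h1 : μ.real Rᶜ ≤ 1 / 2 := by
    rw [hR, Set.compl_inter]
    refine (measureReal_union_le _ _).trans ?_
    have h2 := measureReal_smallRise_compl ν hz hz1 ha (L := L) hm (show u ≤ T by omega)
    have h3 := measureReal_smallFall_compl ν hz hz1 ha (L := L) hT
    linarith
  have h2 : 1 / 2 ≤ μ.real R := by
    rw [probReal_compl_eq_one_sub (Set.to_countable R).measurableSet] at h1
    linarith
  have hdep : DependsOn (· ∈ R)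
      ((slotRange T (u - m) u ∪ slotRange T (u + (2 * L + 1)) (u + (2 * L + 1) + m) :
        Finset (Fin T)) : Set (Fin T)) := by
    refine DependsOn.inter (DependsOn.of_subset (dependsOn_smallRise L (by omega)) ?_)
      (DependsOn.of_subset (dependsOn_smallFall L hT) ?_)
    · exact Finset.coe_subset.2 Finset.subset_union_left
    · exact Finset.coe_subset.2 Finset.subset_union_right
  rw [localPivot, measureReal_inter_of_dependsOn ν ?_ (dependsOn_uniqueRun _ _) hdep,
    measureReal_uniqueRun ν (by omega)]
  · have : 0 ≤ ν.real {(1, 0)} ^ (2 * L + 1) := by positivity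
    nlinarith
  · rw [Finset.disjoint_union_right]
    exact ⟨(disjoint_slotRange le_rfl).symm, disjoint_slotRange le_rfl⟩

/-- None of `n` consecutive blocks of slots after slot `w` has a local pivot. -/
def noLocalPivot (T w m L n : ℕ) : Set (Execution T) :=
  {E | ∀ j < n, E ∉ localPivot T (w + j * (2 * L + 1 + 2 * m) + m) m L}

theorem noLocalPivot_succ (w m L n : ℕ) : noLocalPivot T w m L (n + 1) =
    noLocalPivot T w m L n ∩ (localPivot T (w + n * (2 * L + 1 + 2 * m) + m) m L)ᶜ := by
  ext E
  simp only [noLocalPivot, Set.mem_inter_iff, Set.mem_ofPred_eq, Set.mem_compl_iff]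
  exact Nat.forall_lt_succ_right

/-- The run starts `m` slots into its block, so both fluctuation ranges stay inside the block and
different blocks are independent. -/
theorem dependsOn_noLocalPivot {w m L n : ℕ} (h : w + n * (2 * L + 1 + 2 * m) ≤ T) :
    DependsOn (· ∈ noLocalPivot T w m L n)
      (slotRange T w (w + n * (2 * L + 1 + 2 * m)) : Set (Fin T)) := by
  induction n with
  | zero => exact fun E E' _ => by simp [noLocalPivot]
  | succ n ih =>
    rw [Nat.succ_mul] at h ⊢
    rw [noLocalPivot_succ]
    refine DependsOn.inter (DependsOn.of_subset (ih (by omega)) ?_)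
      (DependsOn.of_subset (DependsOn.compl (dependsOn_localPivot L (by omega))) ?_) <;>
    exact Finset.coe_subset.2 (slotRange_subset (by omega) (by omega))

theorem measureReal_noLocalPivot_le (hz : 0 < z) (hz1 : z < 1)
    (ha : ∫ e, z ^ leaderStep e ∂ν < 1) {w m L n : ℕ}
    (hL : z ^ L * (1 - ∫ e, z ^ leaderStep e ∂ν)⁻¹ ≤ 1 / 4)
    (h : w + n * (2 * L + 1 + 2 * m) ≤ T) :
    (Measure.pi fun _ : Fin T => ν).real (noLocalPivot T w m L n) ≤
      (1 - ν.real {(1, 0)} ^ (2 * L + 1) / 2) ^ n := by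
  induction n with
  | zero => simp
  | succ n ih =>
    rw [Nat.succ_mul] at h
    have h1 := le_measureReal_localPivot ν hz hz1 ha hL (T := T) (m := m)
      (u := w + n * (2 * L + 1 + 2 * m) + m) (by omega) (by omega)
    rw [noLocalPivot_succ, measureReal_inter_of_dependsOn ν ?_
      (dependsOn_noLocalPivot (by omega)) (DependsOn.compl (dependsOn_localPivot L (by omega))),
      probReal_compl_eq_one_sub (Set.to_countable _).measurableSet, pow_succ]
    · have h2 : (Measure.pi fun _ : Fin T => ν).real
          (localPivot T (w + n * (2 * L + 1 + 2 * m) + m) m L) ≤ 1 := measureReal_le_one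
      refine mul_le_mul (ih (by omega)) (by linarith) (by linarith) ?_
      exact pow_nonneg (by linarith) _
    · exact disjoint_slotRange (by omega)

end Bounds

/-- The walk increases over all intervals of length at least `m`. -/
def longRise (T m : ℕ) : Set (Execution T) :=
  {E | ∀ r s, r + m ≤ s → s ≤ T → walk E r < walk E s}

theorem measureReal_longRise_compl {z : ℝ} (hz : 0 < z) (hz1 : z < 1)
    (ha : ∫ e, z ^ leaderStep e ∂ν < 1) (m : ℕ) :
    (Measure.pi fun _ : Fin T => ν).real (longRise T m)ᶜ ≤
      (T + 1) ^ 2 * (∫ e, z ^ leaderStep e ∂ν) ^ m := by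
  classical
  set I := (Finset.range (T + 1) ×ˢ Finset.range (T + 1)).filter fun q => q.1 + m ≤ q.2 with hI
  have hcard : (I.card : ℝ) ≤ (T + 1) ^ 2 := by
    have : I.card ≤ (T + 1) ^ 2 := (Finset.card_filter_le _ _).trans (by simp [sq])
    exact_mod_cast this
  have h0 := integral_zpow_nonneg ν hz
  calc _ ≤ (Measure.pi fun _ : Fin T => ν).real
        (⋃ q ∈ I, {E | walk E q.2 + (0 : ℕ) ≤ walk E q.1}) := by
        refine measureReal_mono (fun E hE => ?_) (measure_ne_top _ _)
        simp only [longRise, Set.mem_compl_iff, Set.mem_ofPred_eq, not_forall, not_lt] at hE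
        obtain ⟨r, s, h1, h2, hE⟩ := hE
        simp only [Set.mem_iUnion, Set.mem_ofPred_eq]
        refine ⟨(r, s), ?_, by simpa using hE⟩
        simp only [hI, Finset.mem_filter, Finset.mem_product, Finset.mem_range]
        omega
    _ ≤ ∑ q ∈ I, (Measure.pi fun _ : Fin T => ν).real
          {E | walk E q.2 + (0 : ℕ) ≤ walk E q.1} := measureReal_biUnion_finset_le _ _
    _ ≤ ∑ q ∈ I, (∫ e, z ^ leaderStep e ∂ν) ^ m := by
        refine Finset.sum_le_sum fun q hq => ?_
        simp only [hI, Finset.mem_filter, Finset.mem_product, Finset.mem_range] at hq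
        have := measureReal_walk_le ν hz hz1 (show q.1 ≤ q.2 by omega)
          (show q.2 ≤ T by omega) 0
        rw [pow_zero, one_mul] at this
        exact this.trans (pow_le_pow_of_le_one h0 ha.le (by omega))
    _ ≤ _ := by
        rw [Finset.sum_const, nsmul_eq_mul]
        gcongr

theorem walk_of_mem_uniqueRun {E : Execution T} {u l k : ℕ} (hE : E ∈ uniqueRun T u l)
    (hT : u + l ≤ T) (hk : k ≤ l) : walk E (u + k) = walk E u + k := by
  have h : ∀ i ∈ slotRange T u (u + k), leaderStep (E i) = 1 := fun i hi => by
    rw [mem_slotRange] at hi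
    rw [hE i hi.1 (by omega)]
    rfl
  rw [walk_eq_add_sum E (Nat.le_add_right u k) (by omega), Finset.sum_congr rfl h]
  simp [card_slotRange (Nat.le_add_right u k) (show u + k ≤ T by omega)]

/-- The pivot is the middle slot of the run. Before it, within distance `m`, the walk is at most `L`
above its value at `u`. From it on the walk is at least `L + 1` above: inside the run by counting,
beyond it because `(2L + 1) - L = L + 1`. Longer intervals are left to `longRise`. -/
theorem isPivot_of_mem_localPivot {E : Execution T} {u m L : ℕ} (hE : E ∈ localPivot T u m L)
    (hE' : E ∈ longRise T m) (hT : u + (2 * L + 1) + m ≤ T) :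
    IsPivot E (u + L + 1) := by
  obtain ⟨h1, h2, h3⟩ := hE
  refine ⟨by omega, ?_, fun r hr s hs hsT => ?_⟩
  · exact uniquelySuccessful_succ (i := ⟨u + L, by omega⟩) (h1 _ (by simp) (by simp; omega))
  · by_cases hrs : r + m ≤ s
    · exact hE' r s hrs hsT
    have hr' : walk E r ≤ walk E u + L := by
      rcases le_total u r with h | h
      · obtain ⟨k, rfl⟩ := Nat.exists_eq_add_of_le h
        rw [walk_of_mem_uniqueRun h1 (by omega) (by omega)]
        omega
      · have := h2 (u - r) (by omega)
        rwa [Nat.sub_sub_self h] at this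
    have hs' : walk E u + L < walk E s := by
      rcases le_total s (u + (2 * L + 1)) with h | h
      · obtain ⟨k, rfl⟩ := Nat.exists_eq_add_of_le (show u ≤ s by omega)
        rw [walk_of_mem_uniqueRun h1 (by omega) (by omega)]
        omega
      · obtain ⟨k, rfl⟩ := Nat.exists_eq_add_of_le h
        have := h3 k (by omega)
        rw [walk_of_mem_uniqueRun h1 (by omega) le_rfl] at this
        push_cast at this
        omega
    omega

/-- The executions in which each window of `W` slots has a pivot. -/
def pivotal (T W : ℕ) : Set (Execution T) :=
  {E | ∀ w, w + W ≤ T → ∃ p, w < p ∧ p ≤ w + W ∧ IsPivot E p}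

theorem measureReal_pivotal_compl {z : ℝ} (hz : 0 < z) (hz1 : z < 1)
    (ha : ∫ e, z ^ leaderStep e ∂ν < 1) (m n : ℕ) {L W : ℕ}
    (hL : z ^ L * (1 - ∫ e, z ^ leaderStep e ∂ν)⁻¹ ≤ 1 / 4)
    (hW : n * (2 * L + 1 + 2 * m) ≤ W) :
    (Measure.pi fun _ : Fin T => ν).real (pivotal T W)ᶜ ≤
      (T + 1) ^ 2 * (∫ e, z ^ leaderStep e ∂ν) ^ m +
        (T + 1) * (1 - ν.real {(1, 0)} ^ (2 * L + 1) / 2) ^ n := by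
  classical
  set I := (Finset.range (T + 1)).filter fun w => w + W ≤ T with hI
  have hp : 0 ≤ 1 - ν.real {(1, 0)} ^ (2 * L + 1) / 2 := by
    have : ν.real {(1, 0)} ^ (2 * L + 1) ≤ 1 := pow_le_one₀ (by positivity) measureReal_le_one
    linarith
  have hcard : (I.card : ℝ) ≤ T + 1 := by
    have : I.card ≤ T + 1 := (Finset.card_filter_le _ _).trans (by simp)
    exact_mod_cast this
  calc _ ≤ (Measure.pi fun _ : Fin T => ν).real
        ((longRise T m)ᶜ ∪ ⋃ w ∈ I, noLocalPivot T w m L n) := by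
        refine measureReal_mono (fun E hE => ?_) (measure_ne_top _ _)
        simp only [pivotal, Set.mem_compl_iff, Set.mem_ofPred_eq, not_forall] at hE
        obtain ⟨w, hw, hE⟩ := hE
        by_cases hl : E ∈ longRise T m
        · right
          simp only [Set.mem_iUnion]
          refine ⟨w, by simp [hI]; omega, fun j hj hE' => hE ?_⟩
          have hjn := Nat.mul_le_mul_right (2 * L + 1 + 2 * m) (Nat.succ_le_of_lt hj)
          rw [Nat.succ_mul] at hjn
          exact ⟨_, by omega, by omega, isPivot_of_mem_localPivot hE' hl (by omega)⟩
        · exact .inl hl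
    _ ≤ (Measure.pi fun _ : Fin T => ν).real (longRise T m)ᶜ +
          ∑ w ∈ I, (Measure.pi fun _ : Fin T => ν).real (noLocalPivot T w m L n) :=
        (measureReal_union_le _ _).trans (by gcongr; exact measureReal_biUnion_finset_le _ _)
    _ ≤ (T + 1) ^ 2 * (∫ e, z ^ leaderStep e ∂ν) ^ m +
          ∑ w ∈ I, (1 - ν.real {(1, 0)} ^ (2 * L + 1) / 2) ^ n := by
        refine add_le_add (measureReal_longRise_compl ν hz hz1 ha m)
          (Finset.sum_le_sum fun w hw => ?_)
        simp only [hI, Finset.mem_filter, Finset.mem_range] at hw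
        exact measureReal_noLocalPivot_le ν hz hz1 ha hL (by omega)
    _ ≤ _ := by
        rw [Finset.sum_const, nsmul_eq_mul]
        gcongr

end Product

/-! ### The law of the leaders of a slot -/

/-- The law of `(H_t, A_t)`. -/
noncomputable def slotLaw (ρ β : ℝ) : Measure (ℕ × ℕ) :=
  (poissonMeasure ((1 - β) * ρ).toNNReal).prod (poissonMeasure (β * ρ).toNNReal)

instance (ρ β : ℝ) : IsProbabilityMeasure (slotLaw ρ β) := by
  unfold slotLaw
  infer_instance

theorem slotLaw_real_singleton {ρ β : ℝ} (h : 0 ≤ (1 - β) * ρ) (h' : 0 ≤ β * ρ) (k : ℕ) :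
    (slotLaw ρ β).real {(k, 0)} = ((1 - β) * ρ) ^ k / k.factorial * Real.exp (-ρ) := by
  rw [slotLaw, ← Set.singleton_prod_singleton, measureReal_prod_prod,
    poissonMeasure_real_singleton, poissonMeasure_real_singleton, Real.coe_toNNReal _ h,
    Real.coe_toNNReal _ h', show -ρ = -((1 - β) * ρ) + -(β * ρ) by ring, Real.exp_add]
  simp
  ring

theorem integral_zpow_leaderStep (ν : Measure (ℕ × ℕ)) [IsProbabilityMeasure ν] (z : ℝ) :
    ∫ e, z ^ leaderStep e ∂ν =
      z⁻¹ + (z - z⁻¹) * ν.real {(1, 0)} + (1 - z⁻¹) * ν.real {(0, 0)} := by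
  have h : ∀ e, z ^ leaderStep e = z⁻¹ + Set.indicator {(1, 0)} (fun _ => z - z⁻¹) e +
      Set.indicator {(0, 0)} (fun _ => 1 - z⁻¹) e := by
    intro e
    unfold leaderStep
    by_cases h1 : e = (1, 0)
    · simp [h1]
    · by_cases h0 : e = (0, 0)
      · simp [h0]
      · simp [h1, h0]
  have hi : ∀ (x : ℕ × ℕ) (c : ℝ), Integrable (Set.indicator {x} fun _ => c) ν := fun x c =>
    (integrable_const c).indicator (measurableSet_singleton x)
  simp_rw [h]
  rw [integral_add (f := fun e => z⁻¹ + Set.indicator {(1, 0)} (fun _ => z - z⁻¹) e)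
      ((integrable_const _).add (hi _ _)) (hi _ _), integral_add (integrable_const _) (hi _ _),
    integral_indicator_const _ (measurableSet_singleton _),
    integral_indicator_const _ (measurableSet_singleton _)]
  simp [mul_comm]

/-- Windows whose length is quadratic in the security parameter have pivots, except with
exponentially small probability. -/
theorem exists_measureReal_pivotal_compl_le (ν : Measure (ℕ × ℕ)) [IsProbabilityMeasure ν] {z : ℝ}
    (hz : 0 < z) (hz1 : z < 1) (ha : ∫ e, z ^ leaderStep e ∂ν < 1)
    (hν : 0 < ν.real {(1, 0)}) :
    ∃ c : ℝ, 0 < c ∧ ∀ T κ : ℕ, 1 ≤ κ → ∃ W : ℕ,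
      (W : ℝ) ≤ c * (κ + Real.log T) ^ 2 ∧
      (Measure.pi fun _ : Fin T => ν).real (pivotal T W)ᶜ ≤ 6 * Real.exp (-κ) := by
  set a := ∫ e, z ^ leaderStep e ∂ν with ha_def
  have ha0 : 0 ≤ a := integral_zpow_nonneg ν hz
  have ha' : 0 < 1 - a := by linarith
  obtain ⟨L, hL⟩ := exists_pow_lt_of_lt_one (show 0 < 1 / 4 * (1 - a) by positivity) hz1
  have hL' : z ^ L * (1 - a)⁻¹ ≤ 1 / 4 := by
    rw [mul_inv_le_iff₀ ha']
    exact hL.le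
  set q := ν.real {(1, 0)} ^ (2 * L + 1) / 2 with hq_def
  have hq : 0 < q := by positivity
  have hq1 : q ≤ 1 := by
    have : ν.real {(1, 0)} ^ (2 * L + 1) ≤ 1 := pow_le_one₀ hν.le measureReal_le_one
    linarith
  refine ⟨(3 / q + 1) * (2 * L + 1 + 2 * (3 / (1 - a) + 1)), by positivity, fun T κ hκ => ?_⟩
  have hlog : 0 ≤ Real.log T := Real.log_natCast_nonneg T
  have hκ' : (1 : ℝ) ≤ κ := by exact_mod_cast hκ
  set y := κ + Real.log T with hy
  have hy1 : 1 ≤ y := by linarith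
  -- The form with `Real.exp (Real.log T)` covers `T = 0` too, where `Real.log 0 = 0`.
  have hT : (T : ℝ) + 1 ≤ 2 * Real.exp (Real.log T) := by
    rcases Nat.eq_zero_or_pos T with rfl | hT
    · simp
    · have : (1 : ℝ) ≤ T := by exact_mod_cast hT
      rw [Real.exp_log (by linarith)]
      linarith
  have key : ∀ {b x : ℝ} {k : ℕ}, 0 ≤ b → 0 < x → b ≤ 1 - x → 3 / x * y ≤ k →
      b ^ k ≤ Real.exp (-(3 * y)) := by
    intro b x k hb hx hbx hk
    calc b ^ k ≤ Real.exp (-x) ^ k := by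
          gcongr
          linarith [Real.add_one_le_exp (-x)]
      _ = Real.exp (-(x * k)) := by rw [← Real.exp_nat_mul]; ring_nf
      _ ≤ Real.exp (-(3 * y)) := by
          rw [div_mul_eq_mul_div, div_le_iff₀ hx] at hk
          rw [Real.exp_le_exp]
          linarith
  -- The factor 3 pays for the union bound: `(T + 1) ^ 2` costs about `2 * Real.log T`, and `3 * y`
  -- exceeds this by at least `κ`.
  set m := ⌈3 / (1 - a) * y⌉₊ with hm
  set n := ⌈3 / q * y⌉₊ with hn
  have hm2 : (m : ℝ) ≤ (3 / (1 - a) + 1) * y := by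
    have := Nat.ceil_lt_add_one (show 0 ≤ 3 / (1 - a) * y by positivity)
    linarith
  have hn2 : (n : ℝ) ≤ (3 / q + 1) * y := by
    have := Nat.ceil_lt_add_one (show 0 ≤ 3 / q * y by positivity)
    linarith
  have hm3 := key ha0 ha' (show a ≤ 1 - (1 - a) by linarith) (Nat.le_ceil (3 / (1 - a) * y))
  have hn3 := key (b := 1 - q) (by linarith) hq le_rfl (Nat.le_ceil (3 / q * y))
  refine ⟨n * (2 * L + 1 + 2 * m), ?_, ?_⟩
  · push_cast
    have h1 : (2 * L + 1 + 2 * m : ℝ) ≤ (2 * L + 1 + 2 * (3 / (1 - a) + 1)) * y := by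
      have : (2 * L + 1 : ℝ) ≤ (2 * L + 1) * y := le_mul_of_one_le_right (by positivity) hy1
      linarith
    calc (n * (2 * L + 1 + 2 * m) : ℝ)
        ≤ ((3 / q + 1) * y) * ((2 * L + 1 + 2 * (3 / (1 - a) + 1)) * y) := by gcongr
      _ = _ := by ring
  · refine (measureReal_pivotal_compl ν hz hz1 ha m n hL' le_rfl).trans ?_
    calc ((T : ℝ) + 1) ^ 2 * a ^ m + (T + 1) * (1 - q) ^ n
        ≤ (2 * Real.exp (Real.log T)) ^ 2 * Real.exp (-(3 * y)) +
          (2 * Real.exp (Real.log T)) * Real.exp (-(3 * y)) := by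
          have : 0 ≤ (1 - q) ^ n := pow_nonneg (by linarith) _
          gcongr
      _ = 4 * Real.exp (2 * Real.log T - 3 * y) + 2 * Real.exp (Real.log T - 3 * y) := by
          rw [mul_pow, ← Real.exp_nat_mul, mul_assoc, mul_assoc, ← Real.exp_add, ← Real.exp_add]
          norm_num
          ring_nf
      _ ≤ 4 * Real.exp (-κ) + 2 * Real.exp (-κ) := by
          gcongr <;> linarith
      _ = 6 * Real.exp (-κ) := by ring

/-! ### Negligible failure probability. -/

theorem Negligible.of_le_add_exp {f g : ℕ → ℝ} (hg : Negligible g)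
    (h : ∀ᶠ κ : ℕ in atTop, f κ ≤ g κ + 6 * Real.exp (-κ)) : Negligible f := by
  intro n hn
  -- One spare power of `κ` absorbs the sum of two terms once `κ > 2`.
  obtain ⟨κ₁, h₁⟩ := hg (n + 1) n.succ_pos
  have h₂ : ∀ᶠ κ : ℕ in atTop, (κ : ℝ) ^ (n + 1) * Real.exp (-κ) < 1 / 6 :=
    ((Real.tendsto_pow_mul_exp_neg_atTop_nhds_zero (n + 1)).comp
      tendsto_natCast_atTop_atTop).eventually_lt_const (by norm_num)
  obtain ⟨κ₂, h₂⟩ := eventually_atTop.1 (h.and h₂)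
  refine ⟨max (max κ₁ κ₂) 2, fun κ hκ => ?_⟩
  simp only [max_lt_iff] at hκ
  obtain ⟨h3, h4⟩ := h₂ κ hκ.1.2.le
  have h5 := h₁ κ hκ.1.1
  have hκ2 : (2 : ℝ) < κ := by exact_mod_cast hκ.2
  have hpos : (0 : ℝ) < κ ^ (n + 1) := by positivity
  have h6 : 6 * Real.exp (-κ) < 1 / (κ : ℝ) ^ (n + 1) := by
    rw [lt_div_iff₀ hpos]
    linarith
  have h7 : 2 * (1 / (κ : ℝ) ^ (n + 1)) ≤ 1 / (κ : ℝ) ^ n := by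
    rw [mul_one_div, div_le_div_iff₀ hpos (by positivity), pow_succ]
    have : (0 : ℝ) < κ ^ n := by positivity
    nlinarith
  linarith

theorem compl_secure_subset {Tx : Type u} {Digest : Type v} {P : Protocol Tx Digest}
    (hinj : Function.Injective P.hash) {β : ℝ} {T K Tconf Tlive W : ℕ} (hW : W ≤ Tconf)
    (hW' : Tconf + W ≤ Tlive) :
    {E : Execution T | ¬ (Safe P Tconf β E ∧ Live P Tconf Tlive β E)} ⊆
      {E | ¬ MaxDL P β E K} ∪ (pivotal T W)ᶜ := by
  intro E hE
  by_contra h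
  simp only [Set.mem_union, Set.mem_ofPred_eq, Set.mem_compl_iff, not_or, not_not] at h
  exact hE ⟨safe_of_pivots hinj h.1 hW h.2, live_of_pivots hinj h.1 hW' h.2⟩

end PoSLC

open PoSLC
theorem theorem1 (ρ β ε₁ : ℝ) (hρ : 0 < ρ) (hβ : 0 ≤ β) (hε₁ : 0 < ε₁) (hε₁' : ε₁ < 1)
    (hrate : (1 - β) * ρ * Real.exp (-ρ) = (1 - Real.exp (-ρ)) / 2 * (1 + ε₁)) :
    ∃ c : ℝ, 0 < c ∧
      ∀ (Tx : Type u) (Digest : Type v) (P : ℕ → Protocol Tx Digest)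
        (K Thor Tconf Tlive : ℕ → ℕ),
        (∀ κ, Function.Injective (P κ).hash) →
        (∀ κ, 0 ≤ (P κ).headerDelay) →
        (∀ κ, 0 < (P κ).bandwidth) →
        (∀ κ, (P κ).slotDuration = (P κ).headerDelay + K κ / (P κ).bandwidth) →
        Negligible (fun κ =>
          (executionLaw ρ β (Thor κ)).real {E | ¬ MaxDL (P κ) β E (K κ)}) →
        (∀ᶠ κ : ℕ in atTop, c * (κ + Real.log (Thor κ)) ^ 2 ≤ Tconf κ) →
        (∀ᶠ κ : ℕ in atTop, Tconf κ + c * (κ + Real.log (Thor κ)) ^ 2 ≤ Tlive κ) →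
        Negligible (fun κ =>
          (executionLaw ρ β (Thor κ)).real
            {E | ¬ (Safe (P κ) (Tconf κ) β E ∧ Live (P κ) (Tconf κ) (Tlive κ) β E)}) := by
  have hexp : 0 < 1 - Real.exp (-ρ) := by
    have : Real.exp (-ρ) < 1 := Real.exp_lt_one_iff.2 (by linarith)
    linarith
  have hU : 0 < (1 - β) * ρ * Real.exp (-ρ) := by rw [hrate]; positivity
  -- The rate condition forces this, so `Real.toNNReal` does not truncate the Poisson mean.
  have hU' : 0 ≤ (1 - β) * ρ := (pos_of_mul_pos_left hU (Real.exp_pos _).le).le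
  have h1 : (slotLaw ρ β).real {(1, 0)} = (1 - Real.exp (-ρ)) / 2 * (1 + ε₁) := by
    rw [slotLaw_real_singleton hU' (by positivity), ← hrate]
    simp
  have h0 : (slotLaw ρ β).real {(0, 0)} = Real.exp (-ρ) := by
    rw [slotLaw_real_singleton hU' (by positivity)]
    simp
  -- With `z = (1 + ε₁)⁻¹` the expectation equals `1 - (1 - exp (-ρ)) * ε₁ ^ 2 / 2`.
  have ha : ∫ e, ((1 + ε₁)⁻¹ : ℝ) ^ leaderStep e ∂(slotLaw ρ β) < 1 := by
    rw [integral_zpow_leaderStep, h1, h0, inv_inv]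
    have h2 : ((1 + ε₁)⁻¹ - (1 + ε₁)) * ((1 - Real.exp (-ρ)) / 2 * (1 + ε₁)) =
        (1 - Real.exp (-ρ)) / 2 * (1 - (1 + ε₁) ^ 2) := by
      field_simp
    rw [h2]
    nlinarith [mul_pos hexp (pow_pos hε₁ 2)]
  obtain ⟨c, hc, h⟩ := exists_measureReal_pivotal_compl_le (slotLaw ρ β) (by positivity)
    (inv_lt_one_of_one_lt₀ (by linarith)) ha (by rw [h1]; positivity)
  refine ⟨c, hc, fun Tx Digest P K Thor Tconf Tlive hinj _ _ _ hDL hconf hlive =>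
    hDL.of_le_add_exp ?_⟩
  filter_upwards [hconf, hlive, eventually_ge_atTop 1] with κ h2 h3 h4
  obtain ⟨W, hW, hp⟩ := h (Thor κ) κ h4
  have : IsProbabilityMeasure (executionLaw ρ β (Thor κ)) := by
    unfold executionLaw
    infer_instance
  have hW1 : W ≤ Tconf κ := by exact_mod_cast hW.trans h2
  have hW2 : Tconf κ + W ≤ Tlive κ := by
    have : (Tconf κ + W : ℝ) ≤ Tlive κ := by linarith
    exact_mod_cast this
  refine (measureReal_mono (compl_secure_subset (K := K κ) (hinj κ) hW1 hW2)
    (measure_ne_top _ _)).trans ((measureReal_union_le _ _).trans ?_)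
  exact add_le_add le_rfl hp
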